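/- Let $D=\{z\in\mathbb{C}: |z|<1\}$ and let $$f(z)=c\prod_{j=1}^{s}\Big(\frac{z-\alpha_j}{1-\overline{\alpha}_j z}\Big)^{n_j}$$ be a finite Blaschke product, where $|c|=1$, $\alpha_1,\dots,\alpha_s\in D$ are distinct and $n_j\ge 1$, normalized so that $f(0)=0$ and $f(1)=1$. Put $A=\{\alpha_1,\dots,\alpha_s\}$, $N=n_1+\cdots+n_s$, and let $B$ be the set of zeros of $f'$ in $D\setminus A$. A path of steepest descent for $|f|$ is a continuous curve $\gamma\colon[a,b]\to\mathbb{C}$, $a<b$, which is differentiable except at finitely many parameters, whose velocity there is a positive multiple of $-\nabla|f|(\gamma(t))$, and along which $|f|$ is (strictly) decreasing. Then: 1. Every path of steepest descent for $|f|$ starting at a point of $D$ remains in $D$ and can be continued to a path of steepest descent ending at a point of $A$; such a path to $A$ exists from every point of $D\setminus A$. 2. The set $B$ is finite. Consider the curves (images) of all paths of steepest descent for $|f|$ that start at a point of $B$, end at a point of $A\cup B$ and do not meet $A\cup B$ in between. There are exactly $s+p-1$ such curves, where $p$ is the number of elements of $B$; two distinct ones meet at most at points of $A\cup B$, and at most one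 of them goes from a given point to another given point. The graph on the vertex set $A\cup B$ whose edges are these curves is a tree. 3. Every path of steepest descent for $|f|$ from a point of $D\setminus A$ to a point of $A$ has length at most $2\pi N$. -/

import Mathlib

open Set Metric

noncomputable section

/-- The finite Blaschke product `c ∏_{α ∈ A} ((z - α) / (1 - conj α * z)) ^ (n α)`, as a rational
function on `ℂ`. When `A` lies in the open unit disk, its poles lie outside the closed unit disk. -/
def blaschkeProduct (c : ℂ) (A : Finset ℂ) (n : ℂ → ℕ) (z : ℂ) : ℂ :=
  c * ∏ α ∈ A, ((z - α) / (1 - (starRingEnd ℂ) α * z)) ^ n α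

/-- `γ` restricted to `[a, b]` is a path of steepest descent for `|f|`: it is continuous, it is
differentiable except at finitely many parameters, with velocity a positive multiple of
`-∇|f|` (so it is an integral curve, up to the speed of the parametrization), and `|f|` is
decreasing along it. -/
structure IsSteepestDescent (f : ℂ → ℂ) (γ : ℝ → ℂ) (a b : ℝ) : Prop where
  lt : a < b
  continuousOn : ContinuousOn γ (Icc a b)
  integralCurve : ∃ S : Finset ℝ, ∀ t ∈ Ioo a b, t ∉ S →
    ∃ r : ℝ, 0 < r ∧ HasDerivAt γ (-(r • gradient (fun z : ℂ => ‖f z‖) (γ t))) t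
  decreasing : StrictAntiOn (fun t => ‖f (γ t)‖) (Icc a b)

/-- The zeros of `f'` in the open unit disk that are not in `A`. -/
def criticalSet (f : ℂ → ℂ) (A : Set ℂ) : Set ℂ :=
  {z | z ∈ ball (0 : ℂ) 1 ∧ z ∉ A ∧ deriv f z = 0}

/-- The vertices of the graph: `A ∪ B`. -/
def vertexSet (f : ℂ → ℂ) (A : Set ℂ) : Set ℂ := A ∪ criticalSet f A

/-- A path of steepest descent from an element of `B` down to the first new element of
`A ∪ B` that it reaches. -/
structure IsEdgePath (f : ℂ → ℂ) (A : Set ℂ) (γ : ℝ → ℂ) (a b : ℝ) : Prop where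
  descent : IsSteepestDescent f γ a b
  source : γ a ∈ criticalSet f A
  target : γ b ∈ vertexSet f A
  interior : ∀ t ∈ Ioo a b, γ t ∉ vertexSet f A

/-- The curves (subsets of `ℂ`, independent of the parametrization) drawn by the edge paths. -/
def edgeCurves (f : ℂ → ℂ) (A : Set ℂ) : Set (Set ℂ) :=
  {C | ∃ (γ : ℝ → ℂ) (a b : ℝ), IsEdgePath f A γ a b ∧ C = γ '' Icc a b}

/-- The graph on `A ∪ B` in which two points are adjacent when an edge path joins them. -/
def descentGraph (f : ℂ → ℂ) (A : Set ℂ) : SimpleGraph (vertexSet f A) :=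
  SimpleGraph.fromRel fun u v =>
    ∃ (γ : ℝ → ℂ) (a b : ℝ), IsEdgePath f A γ a b ∧ γ a = u ∧ γ b = v

end

/-!
Why the theorem is true. Along a path of steepest descent the velocity of `f ∘ γ` is a nonpositive
multiple of `f ∘ γ`, so `f ∘ γ` moves straight towards the origin. Parametrized by the value of
`|f|`, such a path is a lift through `f` of a segment of a ray
(`IsSteepestDescent.exists_isRayLift`), and conversely a lift of a ray is a path of steepest descent
(`IsRayLift.isSteepestDescent`). Everything about existence and uniqueness is therefore a statement
on lifts. Near each point `z₀` of the disk, `f` is a power map `f z₀ + b * w ^ k` in a suitable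
chart (`AnalyticAt.exists_isPowChart`), so the points near `z₀` over its ray are joined to `z₀` by
explicit lifts. As `f` is proper on the disk, every point is joined to a zero
(`IsProperDiskMap.exists_isRayLift`), and lifts can only branch at critical points
(`IsProperDiskMap.eqOn_of_isPreconnected`).

The graph is connected (`IsProperDiskMap.connected`): the set of points from which one can descend
to a given component of the graph is stable under descent and ascent, and such a set is open and
closed in the disk (`IsProperDiskMap.mem_iff_of_descent_invariant`). On the other hand there are
few edges. An edge is determined by its upper end `β` and its direction there, so there are at most
`∑ k β` of them, where `k β` is the order of `f - f β` at `β`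
(`IsProperDiskMap.encard_edgeCurves_le`). Here `k β - 1` is the multiplicity of `β` as a zero of the
numerator of `f' / f`, a self-reciprocal polynomial of degree at most `2 * (s - 1)`, at most half of
whose roots lie in the disk (`two_mul_sum_rootMultiplicity_le`). So `∑ k β ≤ s - 1 + p`, while a
connected graph on `s + p` vertices has at least `s + p - 1` edges. Equality holds throughout: the
graph is a tree, there are `s + p - 1` edge curves, and each pair of vertices is joined by at most
one of them (`IsProperDiskMap.isTree_of_sum_order_le`).

For the length, write `f = P / Q` with polynomials of degree at most `N`. A path of steepest descent
is injective and lies in the real algebraic curve `Im (conj u * P * conj Q) = 0` of degree at most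
`2 * N`, which meets almost every line in at most `2 * N` points
(`IsSteepestDescent.eVariationOn_le`). Crofton's bound for curves in the unit disk then gives the
length `π * (2 * N)` (`eVariationOn_le_of_encard_line_le`).
-/

/-! ### Power charts and lifts of rays -/

section PowerChart
open Filter Topology

/-- A local chart `φ` of `ℂ` at `z₀`, with values covering the closed disk of radius `r`, in which
`f` is the power map `w ↦ f z₀ + b * w ^ k`. -/
structure IsPowChart (f : ℂ → ℂ) (z₀ b : ℂ) (k : ℕ) (φ : OpenPartialHomeomorph ℂ ℂ) (r : ℝ) :
    Prop where
  ne_zero : k ≠ 0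
  pos : 0 < r
  mem_source : z₀ ∈ φ.source
  map_center : φ z₀ = 0
  closedBall_subset : closedBall 0 r ⊆ φ.target
  eq_pow : ∀ z ∈ φ.source, f z = f z₀ + b * φ z ^ k

/-- A nonconstant holomorphic function is a power map in a suitable chart. The chart is
`z ↦ (z - z₀) * h z ^ (1 / k)`, where `f z - f z₀ = b * (z - z₀) ^ k * h z` and `h z₀ ≠ 0`. -/
theorem AnalyticAt.exists_isPowChart {f : ℂ → ℂ} {z₀ b : ℂ} {k : ℕ} {O : Set ℂ}
    (hf : AnalyticAt ℂ f z₀) (hb : b ≠ 0)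
    (hk : analyticOrderAt (fun z => f z - f z₀) z₀ = k) (hO : O ∈ 𝓝 z₀) :
    ∃ φ r, IsPowChart f z₀ b k φ r ∧ φ.source ⊆ O := by
  have hg : AnalyticAt ℂ (fun z => f z - f z₀) z₀ := hf.sub analyticAt_const
  have hk0 : k ≠ 0 := by
    rintro rfl
    have := (hg.analyticOrderAt_eq_zero).1 (by simpa using hk)
    simp at this
  obtain ⟨h, hh, hh0, hfh⟩ := hg.analyticOrderAt_eq_natCast.1 hk
  obtain ⟨c, hc⟩ := IsAlgClosed.exists_pow_nat_eq (h z₀ / b) (Nat.pos_of_ne_zero hk0)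
  have hc0 : c ≠ 0 := by
    rintro rfl
    rw [zero_pow hk0] at hc
    exact div_ne_zero hh0 hb hc.symm
  set ψ : ℂ → ℂ := fun z => (z - z₀) * (c * Complex.exp (Complex.log (h z / h z₀) / k)) with hψ
  have hslit : h z₀ / h z₀ ∈ Complex.slitPlane := by rw [div_self hh0]; simp
  have hE : AnalyticAt ℂ (fun z => c * Complex.exp (Complex.log (h z / h z₀) / k)) z₀ := by
    refine analyticAt_const.mul (AnalyticAt.cexp ?_)
    exact ((hh.div analyticAt_const hh0).clog hslit).div_const
  have hψa : AnalyticAt ℂ ψ z₀ := (analyticAt_id.sub analyticAt_const).mul hE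
  have hd : HasDerivAt ψ c z₀ := by
    have := ((hasDerivAt_id z₀).sub_const z₀).fun_mul hE.differentiableAt.hasDerivAt
    simpa [hψ, div_self hh0] using this
  have hs : HasStrictDerivAt ψ c z₀ := by
    have := hψa.hasStrictDerivAt
    rwa [hd.deriv] at this
  have hequiv := hs.hasStrictFDerivAt_equiv hc0
  set Φ := hequiv.toOpenPartialHomeomorph ψ with hΦ
  have hΦc : ∀ z, Φ z = ψ z := fun z => rfl
  have hmem : z₀ ∈ Φ.source := hequiv.mem_toOpenPartialHomeomorph_source
  have hev : ∀ᶠ z in 𝓝 z₀, f z = f z₀ + b * ψ z ^ k := by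
    have hne : ∀ᶠ z in 𝓝 z₀, h z ≠ 0 := hh.continuousAt.eventually_ne hh0
    filter_upwards [hfh, hne] with z hz hz0
    have : Complex.exp (Complex.log (h z / h z₀) / k) ^ k = h z / h z₀ := by
      rw [← Complex.exp_nat_mul, mul_div_cancel₀ _ (by exact_mod_cast hk0),
        Complex.exp_log (div_ne_zero hz0 hh0)]
    simp only [hψ, mul_pow, this, hc]
    rw [smul_eq_mul] at hz
    field_simp
    linear_combination hz
  obtain ⟨T, hTsub, hTo, hTz⟩ := _root_.mem_nhds_iff.1 (inter_mem hO hev)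
  have hsrc : (Φ.restrOpen T hTo).source = Φ.source ∩ T := rfl
  have hφz : (Φ.restrOpen T hTo) z₀ = 0 := by
    change ψ z₀ = 0
    simp [hψ]
  have hmem' : z₀ ∈ (Φ.restrOpen T hTo).source := ⟨hmem, hTz⟩
  have htgt : (Φ.restrOpen T hTo).target ∈ 𝓝 (0 : ℂ) := by
    rw [← hφz]
    exact (Φ.restrOpen T hTo).open_target.mem_nhds ((Φ.restrOpen T hTo).map_source hmem')
  obtain ⟨r, hr, hrs⟩ := nhds_basis_closedBall.mem_iff.1 htgt
  refine ⟨Φ.restrOpen T hTo, r, ⟨hk0, hr, hmem', hφz, hrs, fun z hz => (hTsub hz.2).2⟩,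
    fun z hz => (hTsub hz.2).1⟩

end PowerChart

section RayLift
open Filter Topology

/-- `σ` lifts the segment `{x • u | x₁ ≤ x ≤ x₀}` of a ray from the origin through `f`, inside the
unit disk. The parameter is the value of `|f|`. -/
structure IsRayLift (f : ℂ → ℂ) (u : ℂ) (σ : ℝ → ℂ) (x₁ x₀ : ℝ) : Prop where
  norm_dir : ‖u‖ = 1
  nonneg : 0 ≤ x₁
  le : x₁ ≤ x₀
  continuousOn : ContinuousOn σ (Icc x₁ x₀)
  mem_ball : ∀ x ∈ Icc x₁ x₀, σ x ∈ ball (0 : ℂ) 1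
  lift : ∀ x ∈ Icc x₁ x₀, f (σ x) = x * u

namespace IsRayLift
variable {f : ℂ → ℂ} {u : ℂ} {σ τ : ℝ → ℂ} {x₁ x₂ x₀ : ℝ}

theorem norm_eq (h : IsRayLift f u σ x₁ x₀) {x : ℝ} (hx : x ∈ Icc x₁ x₀) : ‖f (σ x)‖ = x := by
  rw [h.lift x hx, norm_mul, h.norm_dir, mul_one, Complex.norm_real, Real.norm_of_nonneg
    (h.nonneg.trans hx.1)]

theorem injOn (h : IsRayLift f u σ x₁ x₀) : InjOn σ (Icc x₁ x₀) := by
  intro x hx y hy hxy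
  rw [← h.norm_eq hx, ← h.norm_eq hy, hxy]

theorem dir_ne_zero (h : IsRayLift f u σ x₁ x₀) : u ≠ 0 := by
  rintro rfl
  simpa using h.norm_dir

theorem left_mem (h : IsRayLift f u σ x₁ x₀) : x₁ ∈ Icc x₁ x₀ := left_mem_Icc.2 h.le
theorem right_mem (h : IsRayLift f u σ x₁ x₀) : x₀ ∈ Icc x₁ x₀ := right_mem_Icc.2 h.le

theorem mono (h : IsRayLift f u σ x₁ x₀) {y₁ y₀ : ℝ} (h₁ : x₁ ≤ y₁) (h₁₀ : y₁ ≤ y₀)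
    (h₀ : y₀ ≤ x₀) : IsRayLift f u σ y₁ y₀ :=
  have hs : Icc y₁ y₀ ⊆ Icc x₁ x₀ := Icc_subset_Icc h₁ h₀
  ⟨h.norm_dir, h.nonneg.trans h₁, h₁₀, h.continuousOn.mono hs, fun x hx => h.mem_ball x (hs hx),
    fun x hx => h.lift x (hs hx)⟩

/-- Two lifts whose endpoints fit together can be concatenated. -/
theorem trans (h₁ : IsRayLift f u σ x₁ x₂) (h₂ : IsRayLift f u τ x₂ x₀) (he : σ x₂ = τ x₂) :
    ∃ ρ, IsRayLift f u ρ x₁ x₀ ∧ EqOn ρ σ (Icc x₁ x₂) ∧ EqOn ρ τ (Icc x₂ x₀) := by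
  set ρ : ℝ → ℂ := fun x => if x ≤ x₂ then σ x else τ x with hρ
  have e₁ : EqOn ρ σ (Icc x₁ x₂) := fun x hx => if_pos hx.2
  have e₂ : EqOn ρ τ (Icc x₂ x₀) := by
    intro x hx
    rcases hx.1.eq_or_lt with rfl | h
    · simpa [hρ] using he
    · exact if_neg (not_le.2 h)
  have hun : Icc x₁ x₀ = Icc x₁ x₂ ∪ Icc x₂ x₀ := (Icc_union_Icc_eq_Icc h₁.le h₂.le).symm
  refine ⟨ρ, ⟨h₁.norm_dir, h₁.nonneg, h₁.le.trans h₂.le, ?_, ?_, ?_⟩, e₁, e₂⟩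
  · rw [hun]
    exact (h₁.continuousOn.congr e₁).union_of_isClosed (h₂.continuousOn.congr e₂)
      isClosed_Icc isClosed_Icc
  · intro x hx
    rw [hun] at hx
    rcases hx with hx | hx
    · rw [e₁ hx]; exact h₁.mem_ball x hx
    · rw [e₂ hx]; exact h₂.mem_ball x hx
  · intro x hx
    rw [hun] at hx
    rcases hx with hx | hx
    · rw [e₁ hx]; exact h₁.lift x hx
    · rw [e₂ hx]; exact h₂.lift x hx

end IsRayLift

namespace IsPowChart
variable {f : ℂ → ℂ} {z₀ b : ℂ} {k : ℕ} {φ : OpenPartialHomeomorph ℂ ℂ} {r : ℝ}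

theorem symm_zero (h : IsPowChart f z₀ b k φ r) : φ.symm 0 = z₀ := by
  rw [← h.map_center, φ.left_inv h.mem_source]

theorem source_mem_nhds (h : IsPowChart f z₀ b k φ r) : φ.source ∈ 𝓝 z₀ :=
  φ.open_source.mem_nhds h.mem_source

theorem eventually_norm_lt (h : IsPowChart f z₀ b k φ r) :
    ∀ᶠ z in 𝓝 z₀, z ∈ φ.source ∧ ‖φ z‖ < r := by
  have hc := φ.continuousAt h.mem_source
  rw [ContinuousAt, h.map_center] at hc
  filter_upwards [h.source_mem_nhds, hc (ball_mem_nhds 0 h.pos)] with z h₁ h₂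
  exact ⟨h₁, by simpa using h₂⟩

/-- The cone over `z` in a power chart: the points whose coordinate is `s ^ (1 / k) * φ z`. -/
noncomputable def cone (φ : OpenPartialHomeomorph ℂ ℂ) (k : ℕ) (z : ℂ) (s : ℝ) : ℂ :=
  φ.symm ((s ^ ((k : ℝ)⁻¹) : ℝ) * φ z)

theorem cone_coord_mem (h : IsPowChart f z₀ b k φ r) {z : ℂ} (hzr : ‖φ z‖ ≤ r)
    {s : ℝ} (hs : s ∈ Icc (0 : ℝ) 1) :
    ((s ^ ((k : ℝ)⁻¹) : ℝ) : ℂ) * φ z ∈ φ.target := by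
  refine h.closedBall_subset ?_
  rw [mem_closedBall_zero_iff, norm_mul, Complex.norm_real,
    Real.norm_of_nonneg (Real.rpow_nonneg hs.1 _)]
  calc s ^ ((k : ℝ)⁻¹) * ‖φ z‖ ≤ 1 * ‖φ z‖ := by
        gcongr
        exact Real.rpow_le_one hs.1 hs.2 (by positivity)
    _ ≤ r := by rwa [one_mul]

theorem cone_mem (h : IsPowChart f z₀ b k φ r) {z : ℂ} (hzr : ‖φ z‖ ≤ r)
    {s : ℝ} (hs : s ∈ Icc (0 : ℝ) 1) : cone φ k z s ∈ φ.source :=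
  φ.map_target (h.cone_coord_mem hzr hs)

theorem map_cone (h : IsPowChart f z₀ b k φ r) {z : ℂ} (hz : z ∈ φ.source) (hzr : ‖φ z‖ ≤ r)
    {s : ℝ} (hs : s ∈ Icc (0 : ℝ) 1) : f (cone φ k z s) = f z₀ + s * (f z - f z₀) := by
  rw [h.eq_pow _ (h.cone_mem hzr hs), h.eq_pow z hz, cone, φ.right_inv (h.cone_coord_mem hzr hs),
    mul_pow, ← Complex.ofReal_pow, Real.rpow_inv_natCast_pow hs.1 h.ne_zero]
  ring

theorem continuousOn_cone (h : IsPowChart f z₀ b k φ r) {z : ℂ} (hzr : ‖φ z‖ ≤ r) :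
    ContinuousOn (cone φ k z) (Icc 0 1) := by
  refine φ.continuousOn_symm.comp ?_ fun s hs => h.cone_coord_mem hzr hs
  refine ContinuousOn.mul (Complex.continuous_ofReal.comp_continuousOn ?_) continuousOn_const
  exact (Real.continuous_rpow_const (by positivity)).continuousOn

theorem cone_zero (h : IsPowChart f z₀ b k φ r) (z : ℂ) : cone φ k z 0 = z₀ := by
  have : (k : ℝ)⁻¹ ≠ 0 := inv_ne_zero (by exact_mod_cast h.ne_zero)
  simp [cone, Real.zero_rpow this, h.symm_zero]

theorem cone_one {z : ℂ} (hz : z ∈ φ.source) : cone φ k z 1 = z := by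
  simp [cone, φ.left_inv hz]

/-- Points of a power chart lying over the ray through the value at the center, at a level `x`
different from the level `y` of the center, are joined to the center by a lift of the ray. -/
theorem isRayLift_cone (h : IsPowChart f z₀ b k φ r) (hsub : φ.source ⊆ ball 0 1) {z u : ℂ}
    {x y x₁ x₀ : ℝ} (hz : z ∈ φ.source) (hzr : ‖φ z‖ ≤ r) (hu : ‖u‖ = 1)
    (hfz : f z = x * u) (hf0 : f z₀ = y * u) (hxy : x ≠ y) (h₁ : 0 ≤ x₁) (h₁₀ : x₁ ≤ x₀)
    (hs : MapsTo (fun t => (t - y) / (x - y)) (Icc x₁ x₀) (Icc 0 1)) :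
    IsRayLift f u (fun t => cone φ k z ((t - y) / (x - y))) x₁ x₀ := by
  refine ⟨hu, h₁, h₁₀, ?_, fun t ht => hsub (h.cone_mem hzr (hs ht)), fun t ht => ?_⟩
  · refine (h.continuousOn_cone hzr).comp ?_ hs
    fun_prop
  · rw [h.map_cone hz hzr (hs ht), hfz, hf0]
    have : (x : ℂ) - y ≠ 0 := by exact_mod_cast sub_ne_zero.2 hxy
    push_cast
    field_simp
    ring

theorem exists_isRayLift_down (h : IsPowChart f z₀ b k φ r) (hsub : φ.source ⊆ ball 0 1) {z u : ℂ}
    {x y : ℝ} (hz : z ∈ φ.source) (hzr : ‖φ z‖ ≤ r) (hu : ‖u‖ = 1)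
    (hfz : f z = x * u) (hf0 : f z₀ = y * u) (hy : 0 ≤ y) (hxy : y < x) :
    ∃ σ, IsRayLift f u σ y x ∧ σ x = z ∧ σ y = z₀ := by
  refine ⟨_, h.isRayLift_cone hsub hz hzr hu hfz hf0 hxy.ne' hy hxy.le ?_, ?_, ?_⟩
  · intro t ht
    have := sub_pos.2 hxy
    exact ⟨div_nonneg (by linarith [ht.1]) this.le, (div_le_one this).2 (by linarith [ht.2])⟩
  · simp [div_self (sub_pos.2 hxy).ne', cone_one hz]
  · simp [h.cone_zero]

theorem mapsTo_unit {x y : ℝ} (hxy : x < y) :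
    MapsTo (fun t => (t - y) / (x - y)) (Icc x y) (Icc 0 1) := by
  intro t ht
  have := sub_neg.2 hxy
  exact ⟨div_nonneg_of_nonpos (by linarith [ht.2]) this.le,
    (div_le_one_of_neg this).2 (by linarith [ht.1])⟩

theorem exists_isRayLift_up (h : IsPowChart f z₀ b k φ r) (hsub : φ.source ⊆ ball 0 1) {z u : ℂ}
    {x y : ℝ} (hz : z ∈ φ.source) (hzr : ‖φ z‖ ≤ r) (hu : ‖u‖ = 1)
    (hfz : f z = x * u) (hf0 : f z₀ = y * u) (hx : 0 ≤ x) (hxy : x < y) :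
    ∃ σ, IsRayLift f u σ x y ∧ σ x = z ∧ σ y = z₀ := by
  refine ⟨_, h.isRayLift_cone hsub hz hzr hu hfz hf0 hxy.ne hx hxy.le (mapsTo_unit hxy), ?_, ?_⟩
  · simp [div_self (sub_neg.2 hxy).ne, cone_one hz]
  · simp [h.cone_zero]

end IsPowChart
end RayLift

/-! ### Lifts of rays through proper self-maps of the disk -/

section ProperMap
open Filter Topology

/-- `f` restricts to a proper holomorphic self-map of the open unit disk, continuous up to the
unit circle; `A` is its set of zeros in the disk, and it has finitely many zeros and critical
points there. -/
structure IsProperDiskMap (f : ℂ → ℂ) (A : Set ℂ) : Prop where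
  continuousOn : ContinuousOn f (closedBall 0 1)
  differentiableOn : DifferentiableOn ℂ f (ball 0 1)
  norm_lt_one : ∀ z ∈ ball (0 : ℂ) 1, ‖f z‖ < 1
  norm_eq_one : ∀ z ∈ sphere (0 : ℂ) 1, ‖f z‖ = 1
  mem_zeros : ∀ z, z ∈ A ↔ z ∈ ball (0 : ℂ) 1 ∧ f z = 0
  finite_vertexSet : (vertexSet f A).Finite

/-- Stability of fibers over a compact set: a neighborhood of the fiber over `y` contains the
fibers over all points near `y`. -/
theorem IsCompact.eventually_fiber_subset {X Y : Type*} [TopologicalSpace X] [TopologicalSpace Y]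
    [T2Space Y] {K O : Set X} {f : X → Y} {y : Y} (hK : IsCompact K) (hf : ContinuousOn f K)
    (hO : ∀ w ∈ K, f w = y → O ∈ 𝓝 w) : ∀ᶠ v in 𝓝 y, ∀ z ∈ K, f z = v → z ∈ O := by
  have hc : IsCompact (K \ interior O) := hK.diff isOpen_interior
  have hcl : IsClosed (f '' (K \ interior O)) :=
    (hc.image_of_continuousOn (hf.mono sdiff_subset)).isClosed
  have hy : y ∉ f '' (K \ interior O) := by
    rintro ⟨w, hw, rfl⟩
    exact hw.2 (mem_interior_iff_mem_nhds.2 (hO w hw.1 rfl))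
  filter_upwards [hcl.isOpen_compl.mem_nhds hy] with v hv z hz hzv
  by_contra hzO
  exact hv ⟨z, ⟨hz, fun h => hzO (interior_subset h)⟩, hzv⟩

/-- A connected set that starts inside a power chart and on which `f` stays close to the central
value cannot leave the chart. -/
theorem IsPowChart.subset_of_isPreconnected {f : ℂ → ℂ} {z₀ b : ℂ} {k : ℕ}
    {φ : OpenPartialHomeomorph ℂ ℂ} {r : ℝ} (h : IsPowChart f z₀ b k φ r) {S : Set ℂ}
    (hS : IsPreconnected S) {z : ℂ} (hzS : z ∈ S) (hz : z ∈ φ.source) (hzr : ‖φ z‖ < r)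
    (hlt : ∀ w ∈ S, ‖f w - f z₀‖ < ‖b‖ * r ^ k) :
    S ⊆ φ.symm '' closedBall 0 r := by
  have hK : IsCompact (φ.symm '' closedBall 0 r) :=
    (isCompact_closedBall 0 r).image_of_continuousOn (φ.continuousOn_symm.mono h.closedBall_subset)
  have hV : IsOpen (φ.source ∩ φ ⁻¹' ball 0 r) := φ.isOpen_inter_preimage isOpen_ball
  have hVK : φ.source ∩ φ ⁻¹' ball 0 r ⊆ φ.symm '' closedBall 0 r :=
    fun w hw => ⟨φ w, ball_subset_closedBall hw.2, φ.left_inv hw.1⟩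
  refine Subset.trans ?_ hVK
  refine hS.subset_left_of_subset_union hV hK.isClosed.isOpen_compl ?_ ?_
    ⟨z, hzS, hz, by simpa using hzr⟩
  · exact disjoint_compl_right_iff_subset.2 hVK
  · intro w hw
    by_cases hwK : w ∈ φ.symm '' closedBall 0 r
    · left
      obtain ⟨q, hq, rfl⟩ := hwK
      have hqt := h.closedBall_subset hq
      have hlt' := hlt _ hw
      rw [h.eq_pow _ (φ.map_target hqt), add_sub_cancel_left, norm_mul, norm_pow,
        φ.right_inv hqt] at hlt'
      refine ⟨φ.map_target hqt, ?_⟩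
      have := lt_of_pow_lt_pow_left₀ k h.pos.le (lt_of_mul_lt_mul_left hlt' (norm_nonneg b))
      simpa [φ.right_inv hqt] using this
    · exact Or.inr hwK

namespace IsProperDiskMap
variable {f : ℂ → ℂ} {A : Set ℂ}

theorem analyticAt (h : IsProperDiskMap f A) {z : ℂ} (hz : z ∈ ball (0 : ℂ) 1) :
    AnalyticAt ℂ f z :=
  h.differentiableOn.analyticAt (isOpen_ball.mem_nhds hz)

theorem vertexSet_subset (h : IsProperDiskMap f A) : vertexSet f A ⊆ ball 0 1 := by
  rintro z (hz | hz)
  · exact ((h.mem_zeros z).1 hz).1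
  · exact hz.1

theorem deriv_ne_zero (_h : IsProperDiskMap f A) {z : ℂ} (hz : z ∈ ball (0 : ℂ) 1)
    (hv : z ∉ vertexSet f A) : deriv f z ≠ 0 :=
  fun hd => hv (Or.inr ⟨hz, fun hA => hv (Or.inl hA), hd⟩)

theorem exists_order (h : IsProperDiskMap f A) {z : ℂ} (hz : z ∈ ball (0 : ℂ) 1) :
    ∃ k : ℕ, analyticOrderAt (fun w => f w - f z) z = k := by
  refine (ENat.ne_top_iff_exists.1 fun htop => ?_).imp fun k hk => hk.symm
  rw [analyticOrderAt_eq_top] at htop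
  have hconst : ∀ᶠ w in 𝓝 z, f w = f z := htop.mono fun w hw => sub_eq_zero.1 hw
  refine infinite_of_mem_nhds z ?_ h.finite_vertexSet
  filter_upwards [hconst, eventually_eventually_nhds.2 hconst, isOpen_ball.mem_nhds hz]
    with w hw hw' hwb
  by_cases hA : w ∈ A
  · exact Or.inl hA
  · refine Or.inr ⟨hwb, hA, ?_⟩
    have : f =ᶠ[𝓝 w] fun _ => f z := hw'
    rw [this.deriv_eq, deriv_const]

theorem exists_isPowChart (h : IsProperDiskMap f A) {z b : ℂ} (hz : z ∈ ball (0 : ℂ) 1)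
    (hb : b ≠ 0) : ∃ k φ r, IsPowChart f z b k φ r ∧ φ.source ⊆ ball 0 1 := by
  obtain ⟨k, hk⟩ := h.exists_order hz
  exact ⟨k, (h.analyticAt hz).exists_isPowChart hb hk (isOpen_ball.mem_nhds hz)⟩

/-- Every point of the disk is the upper end of a lift that goes down to a zero. -/
theorem exists_isRayLift (h : IsProperDiskMap f A) {z u : ℂ} {x₀ : ℝ} (hz : z ∈ ball (0 : ℂ) 1)
    (hu : ‖u‖ = 1) (hx₀ : 0 ≤ x₀) (hfz : f z = x₀ * u) :
    ∃ σ, IsRayLift f u σ 0 x₀ ∧ σ x₀ = z := by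
  have hu0 : u ≠ 0 := by rintro rfl; simp at hu
  set E : Set ℝ := {x | 0 ≤ x ∧ x ≤ x₀ ∧ ∃ σ, IsRayLift f u σ x x₀ ∧ σ x₀ = z} with hE
  have hne : E.Nonempty := by
    refine ⟨x₀, hx₀, le_rfl, fun _ => z, ⟨hu, hx₀, le_rfl, continuousOn_const, fun _ _ => hz, ?_⟩,
      rfl⟩
    intro x hx
    rw [Icc_self, mem_singleton_iff] at hx
    rw [hx, hfz]
  have hbdd : BddBelow E := ⟨0, fun x hx => hx.1⟩
  set m := sInf E with hm
  have hm0 : 0 ≤ m := le_csInf hne fun x hx => hx.1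
  have hx₀1 : x₀ < 1 := by
    have := h.norm_lt_one z hz
    rwa [hfz, norm_mul, hu, mul_one, Complex.norm_real, Real.norm_of_nonneg hx₀] at this
  have hmx : m ≤ x₀ := by
    obtain ⟨x, hx⟩ := hne
    exact (csInf_le hbdd hx).trans hx.2.1
  -- the infimum is attained, as each point slightly above level `m` descends to the fiber over `m`
  have hmE : m ∈ E := by
    set O : Set ℂ := {w | ∀ x, m < x → f w = x * u → ∃ σ, IsRayLift f u σ m x ∧ σ x = w} with hO
    have key : ∀ᶠ v in 𝓝 ((m : ℂ) * u), ∀ w ∈ closedBall (0 : ℂ) 1, f w = v → w ∈ O := by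
      refine (isCompact_closedBall 0 1).eventually_fiber_subset h.continuousOn fun w hw hfw => ?_
      have hwb : w ∈ ball (0 : ℂ) 1 := by
        rw [← ball_union_sphere] at hw
        refine hw.resolve_right fun hs => ?_
        have := h.norm_eq_one w hs
        rw [hfw, norm_mul, hu, mul_one, Complex.norm_real, Real.norm_of_nonneg hm0] at this
        linarith
      obtain ⟨k, φ, r, hφ, hsub⟩ := h.exists_isPowChart hwb one_ne_zero
      filter_upwards [hφ.eventually_norm_lt] with w' hw' x hx hfx
      obtain ⟨σ, hσ, h1, -⟩ := hφ.exists_isRayLift_down hsub hw'.1 hw'.2.le hu hfx hfw hm0 hx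
      exact ⟨σ, hσ, h1⟩
    have hcont : Tendsto (fun x : ℝ => (x : ℂ) * u) (𝓝 m) (𝓝 ((m : ℂ) * u)) := by
      have : Continuous fun x : ℝ => (x : ℂ) * u := by fun_prop
      exact this.tendsto m
    obtain ⟨δ, hδ, hball⟩ := Metric.eventually_nhds_iff.1 (hcont.eventually key)
    obtain ⟨x, hxE, hxlt⟩ := exists_lt_of_csInf_lt hne (lt_add_of_pos_right m hδ)
    have hmx' : m ≤ x := csInf_le hbdd hxE
    rcases hmx'.eq_or_lt with rfl | hlt
    · exact hxE
    obtain ⟨hx0, hxx₀, σ, hσ, hσz⟩ := hxE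
    have hd : dist x m < δ := by rw [Real.dist_eq, abs_of_pos (by linarith)]; linarith
    obtain ⟨τ, hτ, hτx⟩ := hball hd (σ x) (ball_subset_closedBall (hσ.mem_ball x hσ.left_mem))
      (hσ.lift x hσ.left_mem) x hlt (hσ.lift x hσ.left_mem)
    obtain ⟨ρ, hρ, -, hρσ⟩ := hτ.trans hσ hτx
    exact ⟨hm0, hmx, ρ, hρ, by rw [hρσ hσ.right_mem, hσz]⟩
  rcases hm0.eq_or_lt with h0 | hpos
  · rw [← h0] at hmE
    exact hmE.2.2
  -- at a positive level the lift can be pushed further down inside a power chart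
  exfalso
  obtain ⟨-, -, σ, hσ, hσz⟩ := hmE
  have hw := hσ.mem_ball m hσ.left_mem
  have hfw := hσ.lift m hσ.left_mem
  have hb : -f (σ m) ≠ 0 := by
    rw [neg_ne_zero, hfw]
    exact mul_ne_zero (by exact_mod_cast hpos.ne') hu0
  obtain ⟨k, φ, r, hφ, hsub⟩ := h.exists_isPowChart hw hb
  have hρ0 : 0 < min r 1 := lt_min hφ.pos one_pos
  set ρ := min r 1 with hρ
  have hρn : ‖(ρ : ℂ)‖ = ρ := by rw [Complex.norm_real, Real.norm_of_nonneg hρ0.le]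
  have hρt : (ρ : ℂ) ∈ φ.target :=
    hφ.closedBall_subset (by rw [mem_closedBall_zero_iff, hρn]; exact min_le_left _ _)
  have hρk : ρ ^ k ≤ 1 := pow_le_one₀ hρ0.le (min_le_right _ _)
  have hρk0 : 0 < ρ ^ k := pow_pos hρ0 k
  have hval : f (φ.symm ρ) = ((m * (1 - ρ ^ k) : ℝ) : ℂ) * u := by
    rw [hφ.eq_pow _ (φ.map_target hρt), φ.right_inv hρt, hfw]
    push_cast
    ring
  have hnn : 0 ≤ m * (1 - ρ ^ k) := mul_nonneg hm0 (by linarith)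
  have hlt : m * (1 - ρ ^ k) < m := by nlinarith
  obtain ⟨τ, hτ, -, hτm⟩ := hφ.exists_isRayLift_up hsub (φ.map_target hρt)
    (by rw [φ.right_inv hρt, hρn]; exact min_le_left _ _) hu hval hfw hnn hlt
  obtain ⟨κ, hκ, -, hκσ⟩ := hτ.trans hσ hτm
  have : m * (1 - ρ ^ k) ∈ E := ⟨hnn, hlt.le.trans hmx, κ, hκ, by rw [hκσ hσ.right_mem, hσz]⟩
  exact absurd (csInf_le hbdd this) (not_le.2 hlt)

theorem exists_injOn (h : IsProperDiskMap f A) {z : ℂ} (hz : z ∈ ball (0 : ℂ) 1)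
    (hv : z ∉ vertexSet f A) : ∃ U ∈ 𝓝 z, InjOn f U := by
  have hs := (h.analyticAt hz).hasStrictDerivAt.hasStrictFDerivAt_equiv (h.deriv_ne_zero hz hv)
  exact ⟨_, (hs.toOpenPartialHomeomorph f).open_source.mem_nhds
    hs.mem_toOpenPartialHomeomorph_source, (hs.toOpenPartialHomeomorph f).injOn⟩

/-- Lifts of the same ray through a common point coincide as long as no vertex is met. -/
theorem eqOn_of_isPreconnected (h : IsProperDiskMap f A) {u : ℂ} {σ τ : ℝ → ℂ}
    {x₁ x₀ y₁ y₀ : ℝ} (hσ : IsRayLift f u σ x₁ x₀) (hτ : IsRayLift f u τ y₁ y₀) {I : Set ℝ}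
    (hI : IsPreconnected I) (hIσ : I ⊆ Icc x₁ x₀) (hIτ : I ⊆ Icc y₁ y₀)
    (hreg : ∀ x ∈ I, σ x ∉ vertexSet f A) {x : ℝ} (hx : x ∈ I) (heq : σ x = τ x) :
    EqOn σ τ I := by
  have hσc : Continuous (I.domRestrict σ) := (hσ.continuousOn.mono hIσ).domRestrict
  have hτc : Continuous (I.domRestrict τ) := (hτ.continuousOn.mono hIτ).domRestrict
  have hclosed : IsClosed {t : I | I.domRestrict σ t = I.domRestrict τ t} := isClosed_eq hσc hτc
  have hopen : IsOpen {t : I | I.domRestrict σ t = I.domRestrict τ t} := by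
    rw [isOpen_iff_mem_nhds]
    intro t ht
    obtain ⟨U, hU, hinj⟩ := h.exists_injOn (hσ.mem_ball t (hIσ t.2)) (hreg t t.2)
    have hU' : U ∈ 𝓝 (I.domRestrict τ t) := by rw [← show _ = _ from ht]; exact hU
    filter_upwards [hσc.continuousAt hU, hτc.continuousAt hU'] with s h₁ h₂
    refine hinj h₁ h₂ ?_
    change f (σ s) = f (τ s)
    rw [hσ.lift s (hIσ s.2), hτ.lift s (hIτ s.2)]
  have : PreconnectedSpace I := isPreconnected_iff_preconnectedSpace.1 hI
  have := IsClopen.eq_univ ⟨hclosed, hopen⟩ ⟨⟨x, hx⟩, heq⟩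
  intro t ht
  exact (this ▸ mem_univ _ : (⟨t, ht⟩ : I) ∈ {t : I | I.domRestrict σ t = I.domRestrict τ t})

theorem _root_.Complex.exists_eq_norm_mul {z : ℂ} : ∃ u : ℂ, ‖u‖ = 1 ∧ z = (‖z‖ : ℂ) * u := by
  by_cases hz : z = 0
  · exact ⟨1, by simp, by simp [hz]⟩
  · have : (‖z‖ : ℂ) ≠ 0 := by exact_mod_cast norm_ne_zero_iff.2 hz
    exact ⟨z / ‖z‖, by simp [norm_ne_zero_iff.2 hz], by field_simp⟩

/-- A set stable under going down and up along lifts of rays is either disjoint from the disk or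
contains it. Its indicator is locally constant: otherwise, take a point `z₀` with the smallest value
of `|f|` where this fails. If `f z₀ = 0`, nearby points descend to `z₀`. Otherwise, the lifts from
nearby points follow closely one of the lifts from `z₀`, down to a lower level where the indicator
is locally constant. -/
theorem mem_iff_of_descent_invariant (h : IsProperDiskMap f A) {W : Set ℂ}
    (hW : ∀ u σ x₁ x₀, IsRayLift f u σ x₁ x₀ → (σ x₀ ∈ W ↔ σ x₁ ∈ W)) {z w : ℂ}
    (hz : z ∈ ball (0 : ℂ) 1) (hw : w ∈ ball (0 : ℂ) 1) : z ∈ W ↔ w ∈ W := by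
  set G : Set ℂ := {p | ∀ᶠ q in 𝓝 p, (q ∈ W ↔ p ∈ W)} with hG
  have hGo : IsOpen G := by
    rw [isOpen_iff_mem_nhds]
    intro p hp
    filter_upwards [hp, eventually_eventually_nhds.2 hp] with q hq hq'
    exact hq'.mono fun s hs => hs.trans hq.symm
  have hball : ball (0 : ℂ) 1 ⊆ G := by
    by_contra hcon
    obtain ⟨p, hp, hpG⟩ := not_subset.1 hcon
    obtain ⟨z₀, ⟨hz₀c, hz₀G⟩, hmin⟩ := ((isCompact_closedBall (0 : ℂ) 1).diff hGo).exists_isMinOn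
      ⟨p, ball_subset_closedBall hp, hpG⟩ ((h.continuousOn.mono sdiff_subset).norm)
    have hlt1 : ‖f z₀‖ < 1 :=
      (hmin ⟨ball_subset_closedBall hp, hpG⟩ : ‖f z₀‖ ≤ ‖f p‖).trans_lt (h.norm_lt_one p hp)
    have hz₀ : z₀ ∈ ball (0 : ℂ) 1 := by
      rw [← ball_union_sphere] at hz₀c
      exact hz₀c.resolve_right fun hs => hlt1.ne (h.norm_eq_one _ hs)
    have hlow : ∀ q ∈ ball (0 : ℂ) 1, ‖f q‖ < ‖f z₀‖ → q ∈ G := fun q hq hlt => by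
      by_contra hqG
      exact (not_le.2 hlt) (hmin ⟨ball_subset_closedBall hq, hqG⟩)
    refine hz₀G ?_
    by_cases hf0 : f z₀ = 0
    · obtain ⟨k, φ, r, hφ, hsub⟩ := h.exists_isPowChart hz₀ one_ne_zero
      filter_upwards [hφ.eventually_norm_lt] with q hq
      obtain ⟨u, hu, hqu⟩ := Complex.exists_eq_norm_mul (z := f q)
      rcases (norm_nonneg (f q)).eq_or_lt with h0 | hpos
      · have h1 := hφ.eq_pow q hq.1
        rw [norm_eq_zero.1 h0.symm, hf0, zero_add, one_mul] at h1
        have h2 : φ q = φ z₀ := by rw [hφ.map_center]; exact pow_eq_zero_iff hφ.ne_zero |>.1 h1.symm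
        rw [φ.injOn hq.1 hφ.mem_source h2]
      · obtain ⟨σ, hσ, h1, h2⟩ := hφ.exists_isRayLift_down hsub hq.1 hq.2.le hu hqu
          (y := 0) (by simp [hf0]) le_rfl hpos
        simpa [h1, h2] using hW _ _ _ _ hσ
    · obtain ⟨k, φ, r, hφ, hsub⟩ := h.exists_isPowChart hz₀ (neg_ne_zero.2 hf0)
      obtain ⟨u₀, hu₀, hzu₀⟩ := Complex.exists_eq_norm_mul (z := f z₀)
      have hy0 : 0 < ‖f z₀‖ := norm_pos_iff.2 hf0
      set η : ℝ := ‖f z₀‖ * r ^ k with hη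
      have hη0 : 0 < η := mul_pos hy0 (pow_pos hφ.pos k)
      set ε : ℝ := min (1 / 2) (η / 2) with hε
      have hε0 : 0 < ε := lt_min (by norm_num) (by linarith)
      have hε1 : ε ≤ 1 / 2 := min_le_left _ _
      have hε2 : ε ≤ η / 2 := min_le_right _ _
      have hK : IsCompact (φ.symm '' closedBall 0 r) :=
        (isCompact_closedBall 0 r).image_of_continuousOn
          (φ.continuousOn_symm.mono hφ.closedBall_subset)
      have hKs : φ.symm '' closedBall 0 r ⊆ φ.source := by
        rintro _ ⟨q, hq, rfl⟩
        exact φ.map_target (hφ.closedBall_subset hq)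
      have hfib := hK.eventually_fiber_subset (f := f) (y := ((1 - ε : ℝ) : ℂ) * f z₀)
        (O := {q | q ∈ W ↔ z₀ ∈ W})
        (h.continuousOn.mono ((hKs.trans hsub).trans ball_subset_closedBall)) (by
          intro q hq hfq
          have hqs := hKs hq
          have hqr : ‖φ q‖ ≤ r := by
            obtain ⟨s, hs, rfl⟩ := hq
            rw [φ.right_inv (hφ.closedBall_subset hs)]
            simpa using hs
          have hfq' : f q = (((1 - ε) * ‖f z₀‖ : ℝ) : ℂ) * u₀ := by
            rw [hfq]
            nth_rewrite 1 [hzu₀]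
            push_cast
            ring
          have hlt : (1 - ε) * ‖f z₀‖ < ‖f z₀‖ := by nlinarith
          have hnn : 0 ≤ (1 - ε) * ‖f z₀‖ := mul_nonneg (by linarith) hy0.le
          obtain ⟨σ, hσ, h1, h2⟩ := hφ.exists_isRayLift_up hsub hqs hqr hu₀ hfq' hzu₀ hnn hlt
          have hqz : z₀ ∈ W ↔ q ∈ W := by simpa [h1, h2] using hW _ _ _ _ hσ
          have hqG : q ∈ G := by
            refine hlow q (hsub hqs) ?_
            rwa [hfq', norm_mul, hu₀, mul_one, Complex.norm_real, Real.norm_of_nonneg hnn]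
          filter_upwards [show ∀ᶠ s in 𝓝 q, (s ∈ W ↔ q ∈ W) from hqG] with s hs
          exact hs.trans hqz.symm)
      have hfc : Tendsto f (𝓝 z₀) (𝓝 (f z₀)) := (h.analyticAt hz₀).continuousAt
      have hfc' : Tendsto (fun q => ((1 - ε : ℝ) : ℂ) * f q) (𝓝 z₀)
        (𝓝 (((1 - ε : ℝ) : ℂ) * f z₀)) := hfc.const_mul _
      filter_upwards [hφ.eventually_norm_lt, hfc'.eventually hfib,
        hfc (ball_mem_nhds (f z₀) (half_pos hη0)), isOpen_ball.mem_nhds hz₀] with q hq hqf hqd hqb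
      obtain ⟨u, hu, hqu⟩ := Complex.exists_eq_norm_mul (z := f q)
      have hfq1 := h.norm_lt_one q hqb
      obtain ⟨σ, hσ, hσq⟩ := h.exists_isRayLift hqb hu (norm_nonneg _) hqu
      have hle : (1 - ε) * ‖f q‖ ≤ ‖f q‖ := by nlinarith [norm_nonneg (f q)]
      have hnn : 0 ≤ (1 - ε) * ‖f q‖ := mul_nonneg (by linarith) (norm_nonneg _)
      have hσ' := hσ.mono hnn hle le_rfl
      have hsubK := hφ.subset_of_isPreconnected (S := σ '' Icc ((1 - ε) * ‖f q‖) ‖f q‖)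
        (isPreconnected_Icc.image _ hσ'.continuousOn) (z := q) ⟨_, hσ'.right_mem, hσq⟩ hq.1 hq.2
        (by
          rintro _ ⟨x, hx, rfl⟩
          have h1 : ‖f (σ x) - f q‖ ≤ ε := by
            have h2 : f (σ x) - f q = ((x - ‖f q‖ : ℝ) : ℂ) * u := by
              rw [hσ'.lift x hx]
              nth_rewrite 1 [hqu]
              push_cast
              ring
            rw [h2, norm_mul, hu, mul_one, Complex.norm_real, Real.norm_eq_abs, abs_le]
            constructor <;> nlinarith [hx.1, hx.2]
          have h3 : ‖f q - f z₀‖ < η / 2 := by simpa [dist_eq_norm] using hqd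
          calc ‖f (σ x) - f z₀‖ = ‖(f (σ x) - f q) + (f q - f z₀)‖ := by congr 1; ring
            _ ≤ _ := norm_add_le _ _
            _ < η := by linarith
            _ = _ := by rw [norm_neg])
      have h1 : σ ((1 - ε) * ‖f q‖) ∈ W ↔ z₀ ∈ W := by
        refine hqf _ (hsubK ⟨_, hσ'.left_mem, rfl⟩) ?_
        rw [hσ'.lift _ hσ'.left_mem]
        nth_rewrite 2 [hqu]
        push_cast
        ring
      rw [← h1]
      simpa [hσq] using hW _ _ _ _ hσ'
  have hWo : ∀ V : Set ℂ, (∀ p q, (q ∈ W ↔ p ∈ W) → p ∈ V → q ∈ V) → IsOpen (G ∩ V) := by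
    intro V hV
    rw [isOpen_iff_mem_nhds]
    rintro p ⟨hp, hpV⟩
    filter_upwards [hGo.mem_nhds hp, hp] with q hq hqp
    exact ⟨hq, hV p q hqp hpV⟩
  have hsplit : ∀ p ∈ ball (0 : ℂ) 1, p ∈ W → ∀ q ∈ ball (0 : ℂ) 1, q ∈ W := by
    intro p hp hpW q hq
    refine ((convex_ball (0 : ℂ) 1).isPreconnected.subset_left_of_subset_union
      (hWo W fun p q hpq hp => hpq.2 hp) (hWo Wᶜ fun p q hpq hp hq => hp (hpq.1 hq)) ?_ ?_
      ⟨p, hp, hball hp, hpW⟩ hq).2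
    · exact disjoint_compl_right.mono inter_subset_right inter_subset_right
    · intro s hs
      by_cases hsW : s ∈ W
      · exact Or.inl ⟨hball hs, hsW⟩
      · exact Or.inr ⟨hball hs, hsW⟩
  exact ⟨fun hzW => hsplit z hz hzW w hw, fun hwW => hsplit w hw hwW z hz⟩

end IsProperDiskMap
end ProperMap

/-! ### Paths of steepest descent as lifts of rays -/

section Descent
open Filter Topology
open scoped ComplexConjugate

/-- Where `f` is holomorphic without zeros, `∇|f| = conj f' * f / |f|`. -/
theorem HasDerivAt.hasGradientAt_norm {f : ℂ → ℂ} {f' z : ℂ} (hf : HasDerivAt f f' z)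
    (h0 : f z ≠ 0) :
    HasGradientAt (fun w => ‖f w‖) (conj f' * (f z / ‖f z‖)) z := by
  have h1 := hf.complexToReal_fderiv.norm_sq
  have h2 := h1.sqrt (pow_ne_zero 2 (norm_ne_zero_iff.2 h0))
  simp only [Real.sqrt_sq (norm_nonneg _)] at h2
  rw [hasGradientAt_iff_hasFDerivAt]
  refine h2.congr_fderiv ?_
  ext v
  have hn : ‖f z‖ ≠ 0 := norm_ne_zero_iff.2 h0
  have : conj f' * (f z / ‖f z‖) = ((‖f z‖⁻¹ : ℝ) : ℂ) * (conj f' * f z) := by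
    push_cast
    field_simp
  rw [this]
  simp [Complex.inner]
  field_simp
  ring

namespace IsRayLift
variable {f : ℂ → ℂ} {A : Set ℂ} {u : ℂ} {σ : ℝ → ℂ} {x₁ x₀ : ℝ}

/-- A lift of a ray meets the finite set of vertices at finitely many parameters. -/
theorem finite_vertices (hσ : IsRayLift f u σ x₁ x₀) (h : IsProperDiskMap f A) :
    {x | x ∈ Icc x₁ x₀ ∧ σ x ∈ vertexSet f A}.Finite :=
  h.finite_vertexSet.of_injOn (f := σ) (fun _ hx => hx.2) (hσ.injOn.mono fun _ hx => hx.1)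

/-- Away from the vertices, a lift of a ray is differentiable, as it is locally the composition of
the segment with an inverse branch of `f`. -/
theorem hasDerivAt (hσ : IsRayLift f u σ x₁ x₀) (h : IsProperDiskMap f A) {x : ℝ}
    (hx : x ∈ Ioo x₁ x₀) (hv : σ x ∉ vertexSet f A) :
    HasDerivAt σ (u / deriv f (σ x)) x := by
  have hxI := Ioo_subset_Icc_self hx
  have hd := h.deriv_ne_zero (hσ.mem_ball x hxI) hv
  have hs := (h.analyticAt (hσ.mem_ball x hxI)).hasStrictDerivAt
  have hinv := (hs.to_localInverse hd).hasDerivAt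
  rw [hσ.lift x hxI] at hinv
  have hline : HasDerivAt (fun t : ℝ => (t : ℂ) * u) u x := by
    simpa using (Complex.ofRealCLM.hasDerivAt (x := x)).mul_const u
  have hcomp := HasDerivAt.comp x hinv hline
  have hct : ContinuousAt σ x := hσ.continuousOn.continuousAt (Icc_mem_nhds hx.1 hx.2)
  rw [inv_mul_eq_div] at hcomp
  refine hcomp.congr_of_eventuallyEq ?_
  filter_upwards [hct.eventually (hs.eventually_left_inverse hd), Icc_mem_nhds hx.1 hx.2]
    with t h1 h2
  rw [Function.comp_apply, ← hσ.lift t h2, h1]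

/-- Run downwards, a lift of a ray is a path of steepest descent. -/
theorem isSteepestDescent (hσ : IsRayLift f u σ x₁ x₀) (h : IsProperDiskMap f A) (hlt : x₁ < x₀)
    (c : ℝ) : IsSteepestDescent f (fun t => σ (c - t)) (c - x₀) (c - x₁) := by
  have hmaps : MapsTo (fun t => c - t) (Icc (c - x₀) (c - x₁)) (Icc x₁ x₀) :=
    fun t ht => ⟨by linarith [ht.2], by linarith [ht.1]⟩
  refine ⟨by linarith, hσ.continuousOn.comp (by fun_prop) hmaps, ?_, ?_⟩
  · refine ⟨(hσ.finite_vertices h).toFinset.image fun x => c - x, fun t ht htS => ?_⟩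
    have hx : c - t ∈ Ioo x₁ x₀ := ⟨by linarith [ht.2], by linarith [ht.1]⟩
    have hxI := Ioo_subset_Icc_self hx
    have hv : σ (c - t) ∉ vertexSet f A := fun hv => htS <| by
      rw [Finset.mem_image]
      exact ⟨c - t, (hσ.finite_vertices h).mem_toFinset.2 ⟨hxI, hv⟩, by ring⟩
    have hb := hσ.mem_ball _ hxI
    have hd := h.deriv_ne_zero hb hv
    have hpos : 0 < c - t := hσ.nonneg.trans_lt hx.1
    have hf0 : f (σ (c - t)) ≠ 0 := by
      rw [hσ.lift _ hxI]
      exact mul_ne_zero (by exact_mod_cast hpos.ne') hσ.dir_ne_zero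
    have hg := ((h.analyticAt hb).differentiableAt.hasDerivAt.hasGradientAt_norm hf0).gradient
    have hder := (hσ.hasDerivAt h hx hv).scomp t ((hasDerivAt_id t).const_sub c)
    have hnd : ‖deriv f (σ (c - t))‖ ≠ 0 := norm_ne_zero_iff.2 hd
    refine ⟨(‖deriv f (σ (c - t))‖ ^ 2)⁻¹, by positivity, ?_⟩
    refine hder.congr_deriv ?_
    rw [hg, hσ.norm_eq hxI, hσ.lift _ hxI]
    have h1 : ((c - t : ℝ) : ℂ) ≠ 0 := by exact_mod_cast hpos.ne'
    have h2 : (((‖deriv f (σ (c - t))‖ ^ 2)⁻¹ : ℝ) : ℂ) =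
        (deriv f (σ (c - t)) * conj (deriv f (σ (c - t))))⁻¹ := by
      rw [Complex.mul_conj']
      push_cast
      rfl
    have h3 : conj (deriv f (σ (c - t))) ≠ 0 := (map_ne_zero _).2 hd
    rw [Complex.real_smul, Complex.real_smul, h2]
    push_cast at h1 ⊢
    field_simp
  · intro s hs t ht hst
    simp only [hσ.norm_eq (hmaps hs), hσ.norm_eq (hmaps ht)]
    linarith

end IsRayLift

/-- Paths of steepest descent whose endpoints fit together can be concatenated. -/
theorem IsSteepestDescent.trans {f : ℂ → ℂ} {γ δ : ℝ → ℂ} {a b d : ℝ}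
    (hγ : IsSteepestDescent f γ a b) (hδ : IsSteepestDescent f δ b d) (he : γ b = δ b) :
    ∃ ρ, IsSteepestDescent f ρ a d ∧ EqOn ρ γ (Icc a b) ∧ EqOn ρ δ (Icc b d) := by
  set ρ : ℝ → ℂ := fun t => if t ≤ b then γ t else δ t with hρ
  have e₁ : EqOn ρ γ (Icc a b) := fun t ht => if_pos ht.2
  have e₂ : EqOn ρ δ (Icc b d) := by
    intro t ht
    rcases ht.1.eq_or_lt with rfl | h
    · simpa [hρ] using he
    · exact if_neg (not_le.2 h)
  have hun : Icc a d = Icc a b ∪ Icc b d := (Icc_union_Icc_eq_Icc hγ.lt.le hδ.lt.le).symm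
  obtain ⟨S, hS⟩ := hγ.integralCurve
  obtain ⟨T, hT⟩ := hδ.integralCurve
  refine ⟨ρ, ⟨hγ.lt.trans hδ.lt, ?_, ⟨insert b (S ∪ T), fun t ht htS => ?_⟩, ?_⟩, e₁, e₂⟩
  · rw [hun]
    exact (hγ.continuousOn.congr e₁).union_of_isClosed (hδ.continuousOn.congr e₂)
      isClosed_Icc isClosed_Icc
  · simp only [Finset.mem_insert, Finset.mem_union, not_or] at htS
    rcases lt_or_gt_of_ne htS.1 with htb | htb
    · obtain ⟨r, hr, hd⟩ := hS t ⟨ht.1, htb⟩ htS.2.1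
      refine ⟨r, hr, ?_⟩
      rw [e₁ ⟨ht.1.le, htb.le⟩]
      exact hd.congr_of_eventuallyEq (Filter.eventuallyEq_of_mem (Icc_mem_nhds ht.1 htb) e₁)
    · obtain ⟨r, hr, hd⟩ := hT t ⟨htb, ht.2⟩ htS.2.2
      refine ⟨r, hr, ?_⟩
      rw [e₂ ⟨htb.le, ht.2.le⟩]
      exact hd.congr_of_eventuallyEq (Filter.eventuallyEq_of_mem (Icc_mem_nhds htb ht.2) e₂)
  · rw [hun]
    refine StrictAntiOn.union (c := b) (hγ.decreasing.congr fun t ht => ?_)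
      (hδ.decreasing.congr fun t ht => ?_) (isGreatest_Icc hγ.lt.le) (isLeast_Icc hδ.lt.le)
    · simp only [e₁ ht]
    · simp only [e₂ ht]

namespace IsSteepestDescent
variable {f : ℂ → ℂ} {A : Set ℂ} {γ : ℝ → ℂ} {a b : ℝ}

theorem left_mem (hγ : IsSteepestDescent f γ a b) : a ∈ Icc a b := left_mem_Icc.2 hγ.lt.le
theorem right_mem (hγ : IsSteepestDescent f γ a b) : b ∈ Icc a b := right_mem_Icc.2 hγ.lt.le

/-- To leave the disk, the path would have to reach the circle, where `|f| = 1`. -/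
theorem mem_ball (hγ : IsSteepestDescent f γ a b) (h : IsProperDiskMap f A)
    (ha : γ a ∈ ball (0 : ℂ) 1) {t : ℝ} (ht : t ∈ Icc a b) : γ t ∈ ball (0 : ℂ) 1 := by
  by_contra hout
  rw [mem_ball_zero_iff, not_lt] at hout
  have hc : ContinuousOn (fun s => ‖γ s‖) (Icc a t) :=
    (hγ.continuousOn.mono (Icc_subset_Icc_right ht.2)).norm
  obtain ⟨s, hs, hs1⟩ := intermediate_value_Icc ht.1 hc ⟨(mem_ball_zero_iff.1 ha).le, hout⟩
  have h1 := h.norm_eq_one (γ s) (mem_sphere_zero_iff_norm.2 hs1)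
  have h2 := hγ.decreasing.antitoneOn hγ.left_mem ⟨hs.1, hs.2.trans ht.2⟩ hs.1
  have h3 := h.norm_lt_one _ ha
  linarith

theorem continuousOn_comp (hγ : IsSteepestDescent f γ a b) (h : IsProperDiskMap f A)
    (ha : γ a ∈ ball (0 : ℂ) 1) : ContinuousOn (fun t => f (γ t)) (Icc a b) :=
  h.continuousOn.comp hγ.continuousOn fun _ ht => ball_subset_closedBall (hγ.mem_ball h ha ht)

/-- Along a path of steepest descent, the argument of `f` is constant: the derivative of `f / |f|`
vanishes, as the velocity of `f` is a real multiple of `f`. -/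
theorem exists_dir (hγ : IsSteepestDescent f γ a b) (h : IsProperDiskMap f A)
    (ha : γ a ∈ ball (0 : ℂ) 1) :
    ∃ u : ℂ, ‖u‖ = 1 ∧ ∀ t ∈ Icc a b, f (γ t) = (‖f (γ t)‖ : ℂ) * u := by
  have hF := hγ.continuousOn_comp h ha
  have hne : ∀ t ∈ Ico a b, f (γ t) ≠ 0 := by
    intro t ht
    have := hγ.decreasing (Ico_subset_Icc_self ht) hγ.right_mem ht.2
    exact norm_pos_iff.1 ((norm_nonneg _).trans_lt this)
  have hab : a ∈ Ico a b := left_mem_Ico.2 hγ.lt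
  obtain ⟨S, hS⟩ := hγ.integralCurve
  have hconst : ∀ t ∈ Ico a b, f (γ t) / ‖f (γ t)‖ = f (γ a) / ‖f (γ a)‖ := by
    intro t ht
    have hsub : Icc a t ⊆ Ico a b := Icc_subset_Ico_right ht.2
    have hint := MeasureTheory.integral_eq_of_hasDerivAt_off_countable_of_le
      (fun s => f (γ s) / (‖f (γ s)‖ : ℂ)) (fun _ => 0) ht.1 S.countable_toSet ?_ ?_
      (by simp)
    · rw [intervalIntegral.integral_zero] at hint
      exact (sub_eq_zero.1 hint.symm)
    · refine (hF.mono (hsub.trans Ico_subset_Icc_self)).div ?_ fun s hs => ?_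
      · exact Complex.continuous_ofReal.comp_continuousOn
          (hF.mono (hsub.trans Ico_subset_Icc_self)).norm
      · exact_mod_cast norm_ne_zero_iff.2 (hne s (hsub hs))
    · rintro s ⟨hs, hsS⟩
      have hsb : s ∈ Ioo a b := ⟨hs.1, hs.2.trans ht.2⟩
      have hs0 := hne s ⟨hs.1.le, hsb.2⟩
      obtain ⟨r, -, hd⟩ := hS s hsb hsS
      have hb := hγ.mem_ball h ha (Ioo_subset_Icc_self hsb)
      have hfd := (h.analyticAt hb).differentiableAt.hasDerivAt
      rw [(hfd.hasGradientAt_norm hs0).gradient] at hd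
      have hn : ‖f (γ s)‖ ≠ 0 := norm_ne_zero_iff.2 hs0
      have hnC : (‖f (γ s)‖ : ℂ) ≠ 0 := by exact_mod_cast hn
      set m : ℝ := -(r * ‖deriv f (γ s)‖ ^ 2 / ‖f (γ s)‖) with hm
      have hcomp : HasDerivAt (fun s => f (γ s)) ((m : ℂ) * f (γ s)) s := by
        refine (HasDerivAt.scomp s hfd hd).congr_deriv ?_
        rw [Complex.real_smul, smul_eq_mul, hm]
        push_cast
        rw [← Complex.mul_conj']
        field_simp
      have hnorm : HasDerivAt (fun s => ‖f (γ s)‖) (m * ‖f (γ s)‖) s := by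
        have h1 := hcomp.norm_sq.sqrt (pow_ne_zero 2 hn)
        simp only [Real.sqrt_sq (norm_nonneg _)] at h1
        refine h1.congr_deriv ?_
        have : inner ℝ (f (γ s)) ((m : ℂ) * f (γ s)) = m * ‖f (γ s)‖ ^ 2 := by
          rw [← Complex.real_smul, inner_smul_right, real_inner_self_eq_norm_sq]
        rw [this]
        field_simp
      refine (hcomp.fun_div hnorm.ofReal_comp hnC).congr_deriv ?_
      push_cast
      rw [div_eq_zero_iff]
      left
      ring
  refine ⟨f (γ a) / ‖f (γ a)‖, ?_, ?_⟩
  · simp [norm_ne_zero_iff.2 (hne a hab)]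
  · have hEq : EqOn (fun t => f (γ t)) (fun t => (‖f (γ t)‖ : ℂ) * (f (γ a) / ‖f (γ a)‖))
        (Ico a b) := by
      intro t ht
      have : (‖f (γ t)‖ : ℂ) ≠ 0 := by exact_mod_cast norm_ne_zero_iff.2 (hne t ht)
      simp only [← hconst t ht]
      field_simp
    refine hEq.of_subset_closure hF ?_ Ico_subset_Icc_self ?_
    · exact (Complex.continuous_ofReal.comp_continuousOn hF.norm).mul continuousOn_const
    · rw [closure_Ico hγ.lt.ne]

/-- A path of steepest descent in the disk, parametrized by `|f|`, is a lift of a ray. -/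
theorem exists_isRayLift (hγ : IsSteepestDescent f γ a b) (h : IsProperDiskMap f A)
    (ha : γ a ∈ ball (0 : ℂ) 1) :
    ∃ u σ, IsRayLift f u σ ‖f (γ b)‖ ‖f (γ a)‖ ∧ ∀ t ∈ Icc a b, σ ‖f (γ t)‖ = γ t := by
  obtain ⟨u, hu, hdir⟩ := hγ.exists_dir h ha
  have hF : ContinuousOn (fun t => ‖f (γ t)‖) (Icc a b) := (hγ.continuousOn_comp h ha).norm
  have hmaps : MapsTo (fun t => ‖f (γ t)‖) (Icc a b) (Icc ‖f (γ b)‖ ‖f (γ a)‖) := fun t ht =>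
    ⟨hγ.decreasing.antitoneOn ht hγ.right_mem ht.2, hγ.decreasing.antitoneOn hγ.left_mem ht ht.1⟩
  have hsurj : SurjOn (fun t => ‖f (γ t)‖) (Icc a b) (Icc ‖f (γ b)‖ ‖f (γ a)‖) :=
    intermediate_value_Icc' hγ.lt.le hF
  have hinj := hγ.decreasing.injOn
  set inv := Function.invFunOn (fun t => ‖f (γ t)‖) (Icc a b) with hinv
  have hleft : ∀ t ∈ Icc a b, inv ‖f (γ t)‖ = t := fun t ht => hinj.leftInvOn_invFunOn ht
  refine ⟨u, γ ∘ inv, ⟨hu, norm_nonneg _, ?_, ?_, ?_, ?_⟩, fun t ht => by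
    rw [Function.comp_apply, hleft t ht]⟩
  · exact (hmaps hγ.left_mem).1
  · -- a continuous bijection from a compact space is a quotient map
    rw [continuousOn_iff_continuous_domRestrict]
    have hc : Continuous (hmaps.restrict _ _ _) := hF.mapsToRestrict hmaps
    have hs : Function.Surjective (hmaps.restrict _ _ _) := by
      rintro ⟨x, hx⟩
      obtain ⟨t, ht, rfl⟩ := hsurj hx
      exact ⟨⟨t, ht⟩, rfl⟩
    rw [(hc.isClosedMap.isQuotientMap hc hs).continuous_iff]
    refine (continuousOn_iff_continuous_domRestrict.1 hγ.continuousOn).congr fun t => ?_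
    change γ t = γ (inv ‖f (γ t)‖)
    rw [hleft t t.2]
  · intro x hx
    obtain ⟨t, ht, rfl⟩ := hsurj hx
    simp only [Function.comp_apply, hleft t ht]
    exact hγ.mem_ball h ha ht
  · intro x hx
    obtain ⟨t, ht, rfl⟩ := hsurj hx
    simp only [Function.comp_apply, hleft t ht]
    exact hdir t ht

end IsSteepestDescent
end Descent

/-! ### Edges and connectedness of the graph -/

section Graph
open Filter Topology

/-- A lift of a ray joining two vertices without meeting a vertex in between. -/
structure IsEdgeLift (f : ℂ → ℂ) (A : Set ℂ) (u : ℂ) (σ : ℝ → ℂ) (x₁ x₀ : ℝ) : Prop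
    extends IsRayLift f u σ x₁ x₀ where
  lt : x₁ < x₀
  source : σ x₀ ∈ vertexSet f A
  target : σ x₁ ∈ vertexSet f A
  interior : ∀ x ∈ Ioo x₁ x₀, σ x ∉ vertexSet f A

variable {f : ℂ → ℂ} {A : Set ℂ} {u v : ℂ} {σ τ : ℝ → ℂ} {x₁ x₀ y₁ y₀ : ℝ}

namespace IsEdgeLift

theorem source_mem (hσ : IsEdgeLift f A u σ x₁ x₀) (h : IsProperDiskMap f A) :
    σ x₀ ∈ criticalSet f A := by
  refine hσ.source.resolve_left fun hA => ?_
  have h1 := hσ.norm_eq hσ.right_mem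
  rw [((h.mem_zeros _).1 hA).2, norm_zero] at h1
  linarith [hσ.nonneg, hσ.lt]

theorem exists_isEdgePath (hσ : IsEdgeLift f A u σ x₁ x₀) (h : IsProperDiskMap f A) :
    ∃ γ a b, IsEdgePath f A γ a b ∧ γ a = σ x₀ ∧ γ b = σ x₁ ∧ γ '' Icc a b = σ '' Icc x₁ x₀ := by
  refine ⟨_, _, _, ⟨hσ.isSteepestDescent h hσ.lt 0, ?_, ?_, ?_⟩, ?_, ?_, ?_⟩
  · simpa using hσ.source_mem h
  · simpa using hσ.target
  · intro t ht
    exact hσ.interior _ ⟨by linarith [ht.2], by linarith [ht.1]⟩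
  · simp
  · simp
  · rw [show (fun t => σ (0 - t)) = σ ∘ (fun t => 0 - t) from rfl, image_comp,
      image_const_sub_Icc]
    simp

theorem mem_interior (hσ : IsEdgeLift f A u σ x₁ x₀) {x : ℝ} (hx : x ∈ Icc x₁ x₀)
    (hv : σ x ∉ vertexSet f A) : x ∈ Ioo x₁ x₀ := by
  refine ⟨hx.1.lt_of_ne ?_, hx.2.lt_of_ne ?_⟩
  · rintro rfl; exact hv hσ.target
  · rintro rfl; exact hv hσ.source

end IsEdgeLift

/-- Parametrized by `|f|`, an edge path is a lift of a ray with the same image and endpoints. -/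
theorem IsEdgePath.exists_isEdgeLift {γ : ℝ → ℂ} {a b : ℝ} (hγ : IsEdgePath f A γ a b)
    (h : IsProperDiskMap f A) :
    ∃ u σ x₁ x₀, IsEdgeLift f A u σ x₁ x₀ ∧ σ x₀ = γ a ∧ σ x₁ = γ b ∧
      σ '' Icc x₁ x₀ = γ '' Icc a b := by
  have hd := hγ.descent
  have ha : γ a ∈ ball (0 : ℂ) 1 := hγ.source.1
  obtain ⟨u, σ, hσ, hσγ⟩ := hd.exists_isRayLift h ha
  have hF : ContinuousOn (fun t => ‖f (γ t)‖) (Icc a b) := (hd.continuousOn_comp h ha).norm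
  have hsurj : SurjOn (fun t => ‖f (γ t)‖) (Icc a b) (Icc ‖f (γ b)‖ ‖f (γ a)‖) :=
    intermediate_value_Icc' hd.lt.le hF
  have hmaps : MapsTo (fun t => ‖f (γ t)‖) (Icc a b) (Icc ‖f (γ b)‖ ‖f (γ a)‖) := fun t ht =>
    ⟨hd.decreasing.antitoneOn ht hd.right_mem ht.2, hd.decreasing.antitoneOn hd.left_mem ht ht.1⟩
  refine ⟨u, σ, _, _, ⟨hσ, hd.decreasing hd.left_mem hd.right_mem hd.lt, ?_, ?_, ?_⟩,
    hσγ a hd.left_mem, hσγ b hd.right_mem, ?_⟩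
  · rw [hσγ a hd.left_mem]
    exact Or.inr hγ.source
  · rw [hσγ b hd.right_mem]
    exact hγ.target
  · intro x hx
    obtain ⟨t, ht, rfl⟩ := hsurj (Ioo_subset_Icc_self hx)
    simp only [hσγ t ht]
    refine hγ.interior t ⟨ht.1.lt_of_ne ?_, ht.2.lt_of_ne ?_⟩
    · rintro rfl; exact lt_irrefl _ hx.2
    · rintro rfl; exact lt_irrefl _ hx.1
  · ext p
    constructor
    · rintro ⟨x, hx, rfl⟩
      obtain ⟨t, ht, rfl⟩ := hsurj hx
      exact ⟨t, ht, (hσγ t ht).symm⟩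
    · rintro ⟨t, ht, rfl⟩
      exact ⟨_, hmaps ht, hσγ t ht⟩

namespace IsRayLift

/-- Two lifts through a common point reach it at the same level, and over the same ray unless that
point is a zero. -/
theorem level_eq (hσ : IsRayLift f u σ x₁ x₀) (hτ : IsRayLift f v τ y₁ y₀) {x y : ℝ}
    (hx : x ∈ Icc x₁ x₀) (hy : y ∈ Icc y₁ y₀) (he : σ x = τ y) :
    x = y ∧ (0 < x → u = v) := by
  have hxy : x = y := by rw [← hσ.norm_eq hx, ← hτ.norm_eq hy, he]
  refine ⟨hxy, fun hpos => ?_⟩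
  have h1 := hσ.lift x hx
  rw [he, hτ.lift y hy, ← hxy] at h1
  exact mul_left_cancel₀ (by exact_mod_cast hpos.ne') h1.symm

end IsRayLift

namespace IsProperDiskMap

/-- Uniqueness of lifts without interior vertices, including the endpoints. -/
theorem eqOn_Icc (h : IsProperDiskMap f A) (hσ : IsRayLift f u σ x₁ x₀)
    (hτ : IsRayLift f u τ y₁ y₀) {m₁ m₀ x : ℝ} {I : Set ℝ} (hI : IsPreconnected I)
    (hIm : Ioo m₁ m₀ ⊆ I) (hlt : m₁ < m₀) (hIc : I ⊆ Icc m₁ m₀)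
    (h₁ : Icc m₁ m₀ ⊆ Icc x₁ x₀) (h₂ : Icc m₁ m₀ ⊆ Icc y₁ y₀)
    (hreg : ∀ t ∈ I, σ t ∉ vertexSet f A) (hx : x ∈ I) (he : σ x = τ x) :
    EqOn σ τ (Icc m₁ m₀) := by
  have heq := h.eqOn_of_isPreconnected hσ hτ hI (hIc.trans h₁) (hIc.trans h₂) hreg hx he
  refine (heq.mono hIm).of_subset_closure (hσ.continuousOn.mono h₁) (hτ.continuousOn.mono h₂)
    Ioo_subset_Icc_self ?_
  rw [closure_Ioo hlt.ne]

/-- Two edges with a common point that is not a vertex coincide. -/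
theorem edgeLift_eq (h : IsProperDiskMap f A) (hσ : IsEdgeLift f A u σ x₁ x₀)
    (hτ : IsEdgeLift f A v τ y₁ y₀) {p : ℂ} (hpσ : p ∈ σ '' Icc x₁ x₀)
    (hpτ : p ∈ τ '' Icc y₁ y₀) (hp : p ∉ vertexSet f A) :
    σ '' Icc x₁ x₀ = τ '' Icc y₁ y₀ := by
  obtain ⟨x, hx, rfl⟩ := hpσ
  obtain ⟨y, hy, he⟩ := hpτ
  have hxo := hσ.mem_interior hx hp
  have hyo := hτ.mem_interior hy (by rwa [he])
  obtain ⟨rfl, huv⟩ := hσ.toIsRayLift.level_eq hτ.toIsRayLift hx hy he.symm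
  obtain rfl := huv (hσ.nonneg.trans_lt hxo.1)
  have hlt : max x₁ y₁ < min x₀ y₀ :=
    (max_lt hxo.1 hyo.1).trans (lt_min hxo.2 hyo.2)
  have heq := h.eqOn_Icc hσ.toIsRayLift hτ.toIsRayLift (isPreconnected_Ioo (a := max x₁ y₁)
    (b := min x₀ y₀)) Subset.rfl hlt Ioo_subset_Icc_self
    (Icc_subset_Icc (le_max_left _ _) (min_le_left _ _))
    (Icc_subset_Icc (le_max_right _ _) (min_le_right _ _))
    (fun t ht => hσ.interior t ⟨(le_max_left _ _).trans_lt ht.1, ht.2.trans_le (min_le_left _ _)⟩)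
    ⟨max_lt hxo.1 hyo.1, lt_min hxo.2 hyo.2⟩ he.symm
  have e0 : x₀ = y₀ := by
    have hm := heq (right_mem_Icc.2 hlt.le)
    rcases lt_trichotomy x₀ y₀ with hl | hl | hl
    · rw [min_eq_left hl.le] at hm
      exact absurd (hm ▸ hσ.source) (hτ.interior _ ⟨hyo.1.trans hxo.2, hl⟩)
    · exact hl
    · rw [min_eq_right hl.le] at hm
      exact absurd (hm.symm ▸ hτ.source) (hσ.interior _ ⟨hxo.1.trans hyo.2, hl⟩)
  have e1 : x₁ = y₁ := by
    have hm := heq (left_mem_Icc.2 hlt.le)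
    rcases lt_trichotomy x₁ y₁ with hl | hl | hl
    · rw [max_eq_right hl.le] at hm
      exact absurd (hm.symm ▸ hτ.target) (hσ.interior _ ⟨hl, hyo.1.trans hxo.2⟩)
    · exact hl
    · rw [max_eq_left hl.le] at hm
      exact absurd (hm ▸ hσ.target) (hτ.interior _ ⟨hl, hxo.1.trans hyo.2⟩)
  subst e0 e1
  simp only [max_self, min_self] at heq
  exact heq.image_eq

/-- The image of a lift determines its endpoints: these are the points with the extreme values
of `|f|`. -/
theorem _root_.IsRayLift.endpoints_eq (hσ : IsRayLift f u σ x₁ x₀) (hτ : IsRayLift f v τ y₁ y₀)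
    (he : σ '' Icc x₁ x₀ = τ '' Icc y₁ y₀) : σ x₀ = τ y₀ ∧ σ x₁ = τ y₁ := by
  have key : ∀ {u v : ℂ} {σ τ : ℝ → ℂ} {x₁ x₀ y₁ y₀ : ℝ}, IsRayLift f u σ x₁ x₀ →
      IsRayLift f v τ y₁ y₀ → σ '' Icc x₁ x₀ = τ '' Icc y₁ y₀ → y₁ ≤ x₁ ∧ x₀ ≤ y₀ := by
    intro u v σ τ x₁ x₀ y₁ y₀ hσ hτ he
    obtain ⟨s, hs, hs'⟩ : σ x₁ ∈ τ '' Icc y₁ y₀ := he ▸ mem_image_of_mem σ hσ.left_mem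
    obtain ⟨t, ht, ht'⟩ : σ x₀ ∈ τ '' Icc y₁ y₀ := he ▸ mem_image_of_mem σ hσ.right_mem
    rw [(hσ.level_eq hτ hσ.left_mem hs hs'.symm).1, (hσ.level_eq hτ hσ.right_mem ht ht'.symm).1]
    exact ⟨hs.1, ht.2⟩
  have e1 : x₁ = y₁ := le_antisymm (key hτ hσ he.symm).1 (key hσ hτ he).1
  have e0 : x₀ = y₀ := le_antisymm (key hσ hτ he).2 (key hτ hσ he.symm).2
  subst e0 e1
  obtain ⟨s, hs, hs'⟩ : σ x₁ ∈ τ '' Icc x₁ x₀ := he ▸ mem_image_of_mem σ hσ.left_mem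
  obtain ⟨t, ht, ht'⟩ : σ x₀ ∈ τ '' Icc x₁ x₀ := he ▸ mem_image_of_mem σ hσ.right_mem
  have h1 := (hσ.level_eq hτ hσ.left_mem hs hs'.symm).1
  have h2 := (hσ.level_eq hτ hσ.right_mem ht ht'.symm).1
  subst h1 h2
  exact ⟨ht'.symm, hs'.symm⟩

theorem adj_of_edgeLift (h : IsProperDiskMap f A) (hσ : IsEdgeLift f A u σ x₁ x₀) :
    (descentGraph f A).Adj ⟨σ x₀, hσ.source⟩ ⟨σ x₁, hσ.target⟩ := by
  obtain ⟨γ, a, b, hγ, ha, hb, -⟩ := hσ.exists_isEdgePath h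
  rw [descentGraph, SimpleGraph.fromRel_adj]
  refine ⟨fun he => ?_, Or.inl ⟨γ, a, b, hγ, ha, hb⟩⟩
  exact hσ.lt.ne' (hσ.injOn hσ.right_mem hσ.left_mem (congrArg Subtype.val he))

/-- A lift of a ray from a vertex down to a vertex decomposes into edges. -/
theorem reachable_of_isRayLift (h : IsProperDiskMap f A) (hσ : IsRayLift f u σ x₁ x₀)
    (h₀ : σ x₀ ∈ vertexSet f A) (h₁ : σ x₁ ∈ vertexSet f A) :
    (descentGraph f A).Reachable ⟨σ x₀, h₀⟩ ⟨σ x₁, h₁⟩ := by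
  have hfin := hσ.finite_vertices h
  by_contra hcon
  -- the highest vertex on the lift that cannot be reached from its top
  set X : Set ℝ := {x | x ∈ Icc x₁ x₀ ∧ ∃ hx : σ x ∈ vertexSet f A,
    ¬ (descentGraph f A).Reachable ⟨σ x₀, h₀⟩ ⟨σ x, hx⟩} with hX
  have hXfin : X.Finite := hfin.subset fun x hx => ⟨hx.1, hx.2.1⟩
  obtain ⟨x, ⟨hxI, hxv, hxr⟩, hxmax⟩ := hXfin.exists_maximal ⟨x₁, hσ.left_mem, h₁, hcon⟩
  have hlt : x < x₀ := by
    refine hxI.2.lt_of_ne ?_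
    rintro rfl
    exact hxr (SimpleGraph.Reachable.refl _)
  -- the next vertex above it
  obtain ⟨y, ⟨⟨hyI, hyv⟩, hxy⟩, hymin⟩ := (hfin.inter_of_left {y | x < y}).exists_minimal
    ⟨x₀, ⟨hσ.right_mem, h₀⟩, hlt⟩
  have hyr : (descentGraph f A).Reachable ⟨σ x₀, h₀⟩ ⟨σ y, hyv⟩ := by
    by_contra hyr
    exact absurd (hxmax ⟨hyI, hyv, hyr⟩ (le_of_lt hxy)) (not_le.2 hxy)
  have hedge : IsEdgeLift f A u σ x y :=
    ⟨hσ.mono hxI.1 (le_of_lt hxy) hyI.2, hxy, hyv, hxv, fun t ht htv =>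
      absurd (hymin ⟨⟨⟨hxI.1.trans ht.1.le, ht.2.le.trans hyI.2⟩, htv⟩, ht.1⟩ ht.2.le)
        (not_le.2 ht.2)⟩
  exact hxr (hyr.trans (h.adj_of_edgeLift hedge).reachable)

/-- A lift of a ray that ends at a vertex meets a first vertex on its way down. -/
theorem exists_first_vertex (h : IsProperDiskMap f A) (hσ : IsRayLift f u σ x₁ x₀)
    (h₁ : σ x₁ ∈ vertexSet f A) :
    ∃ x ∈ Icc x₁ x₀, σ x ∈ vertexSet f A ∧ ∀ y ∈ Ioc x x₀, σ y ∉ vertexSet f A := by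
  obtain ⟨x, ⟨hxI, hxv⟩, hxmax⟩ := (hσ.finite_vertices h).exists_maximal ⟨x₁, hσ.left_mem, h₁⟩
  exact ⟨x, hxI, hxv, fun y hy hyv =>
    absurd (hxmax ⟨⟨hxI.1.trans hy.1.le, hy.2⟩, hyv⟩ hy.1.le) (not_le.2 hy.1)⟩

/-- All vertices below a given point lie in the same component of the graph, since all lifts from
that point pass through the same first vertex. -/
theorem reachable_of_same_top (h : IsProperDiskMap f A) (hσ : IsRayLift f u σ x₁ x₀)
    (hτ : IsRayLift f v τ y₁ y₀) (he : σ x₀ = τ y₀) (h₁ : σ x₁ ∈ vertexSet f A)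
    (h₂ : τ y₁ ∈ vertexSet f A) :
    (descentGraph f A).Reachable ⟨σ x₁, h₁⟩ ⟨τ y₁, h₂⟩ := by
  obtain ⟨e0, huv⟩ := hσ.level_eq hτ hσ.right_mem hτ.right_mem he
  subst e0
  rcases (hσ.nonneg.trans hσ.le).eq_or_lt with h0 | hpos
  · have e1 : x₁ = x₀ := le_antisymm hσ.le (h0 ▸ hσ.nonneg)
    have e2 : y₁ = x₀ := le_antisymm hτ.le (h0 ▸ hτ.nonneg)
    subst e1
    subst e2
    have : (⟨σ y₁, h₁⟩ : vertexSet f A) = ⟨τ y₁, h₂⟩ := Subtype.ext he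
    rw [this]
  obtain rfl := huv hpos
  obtain ⟨x, hxI, hxv, hxf⟩ := h.exists_first_vertex hσ h₁
  obtain ⟨y, hyI, hyv, hyf⟩ := h.exists_first_vertex hτ h₂
  have key : ∀ {σ τ : ℝ → ℂ} {x₁ y₁ x y : ℝ}, IsRayLift f u σ x₁ x₀ → IsRayLift f u τ y₁ x₀ →
      σ x₀ = τ x₀ → x ∈ Icc x₁ x₀ → y ∈ Icc y₁ x₀ → σ x ∈ vertexSet f A →
      (∀ t ∈ Ioc x x₀, σ t ∉ vertexSet f A) → (∀ t ∈ Ioc y x₀, τ t ∉ vertexSet f A) →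
      y ≤ x → x = y ∧ σ x = τ x := by
    intro σ τ x₁ y₁ x y hσ hτ he hxI hyI hxv hxf hyf hyx
    have hst : σ x = τ x := by
      rcases hxI.2.eq_or_lt with rfl | hlt
      · exact he
      · exact h.eqOn_Icc hσ hτ (isPreconnected_Ioc (a := x) (b := x₀)) Ioo_subset_Ioc_self hlt
          Ioc_subset_Icc_self (Icc_subset_Icc_left hxI.1) (Icc_subset_Icc_left (hyI.1.trans hyx))
          hxf ⟨hlt, le_rfl⟩ he (left_mem_Icc.2 hlt.le)
    refine ⟨hyx.eq_or_lt.elim Eq.symm fun hlt => ?_, hst⟩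
    exact absurd (hst ▸ hxv) (hyf x ⟨hlt, hxI.2⟩)
  have hxy : x = y ∧ σ x = τ x := by
    rcases le_total y x with hle | hle
    · exact key hσ hτ he hxI hyI hxv hxf hyf hle
    · obtain ⟨rfl, h2⟩ := key hτ hσ he.symm hyI hxI hyv hyf hxf hle
      exact ⟨rfl, h2.symm⟩
  obtain ⟨rfl, hst⟩ := hxy
  have r1 := h.reachable_of_isRayLift (hσ.mono le_rfl hxI.1 hxI.2) hxv h₁
  have r2 := h.reachable_of_isRayLift (hτ.mono le_rfl hyI.1 hyI.2) hyv h₂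
  have : (⟨σ x, hxv⟩ : vertexSet f A) = ⟨τ x, hyv⟩ := Subtype.ext hst
  rw [this] at r1
  exact r1.symm.trans r2

theorem exists_isRayLift_zero (h : IsProperDiskMap f A) {z : ℂ} (hz : z ∈ ball (0 : ℂ) 1) :
    ∃ u σ, IsRayLift f u σ 0 ‖f z‖ ∧ σ ‖f z‖ = z ∧ σ 0 ∈ A := by
  obtain ⟨u, hu, hzu⟩ := Complex.exists_eq_norm_mul (z := f z)
  obtain ⟨σ, hσ, hσz⟩ := h.exists_isRayLift hz hu (norm_nonneg _) hzu
  refine ⟨u, σ, hσ, hσz, (h.mem_zeros _).2 ⟨hσ.mem_ball 0 hσ.left_mem, ?_⟩⟩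
  rw [hσ.lift 0 hσ.left_mem]
  simp

/-- The graph is connected: the set of points from which one can descend to the component of a
given vertex is stable under descent and ascent. -/
theorem connected (h : IsProperDiskMap f A) : (descentGraph f A).Connected := by
  have hzero : (0 : ℂ) ∈ ball (0 : ℂ) 1 := by simp
  refine (SimpleGraph.connected_iff _).2 ⟨?_, ?_⟩
  swap
  · obtain ⟨u, σ, -, -, hA⟩ := h.exists_isRayLift_zero hzero
    exact ⟨⟨σ 0, Or.inl hA⟩⟩
  intro v w
  set W : Set ℂ := {z | ∃ u τ y₁ y₀, IsRayLift f u τ y₁ y₀ ∧ τ y₀ = z ∧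
    ∃ hv : τ y₁ ∈ vertexSet f A, (descentGraph f A).Reachable v ⟨τ y₁, hv⟩} with hW
  have hinv : ∀ u σ x₁ x₀, IsRayLift f u σ x₁ x₀ → (σ x₀ ∈ W ↔ σ x₁ ∈ W) := by
    intro u σ x₁ x₀ hσ
    constructor
    · rintro ⟨u', τ, y₁, y₀, hτ, hτσ, hv, hr⟩
      obtain ⟨σ', hσ', hbot⟩ := h.exists_isRayLift (hσ.mem_ball _ hσ.left_mem) hσ.norm_dir hσ.nonneg
        (hσ.lift _ hσ.left_mem)
      have hA : σ' 0 ∈ A := by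
        refine (h.mem_zeros _).2 ⟨hσ'.mem_ball 0 hσ'.left_mem, ?_⟩
        rw [hσ'.lift 0 hσ'.left_mem]
        simp
      obtain ⟨ρ, hρ, hρσ', hρσ⟩ := hσ'.trans hσ hbot
      have hρ0 : ρ 0 = σ' 0 := hρσ' hσ'.left_mem
      refine ⟨u, σ', 0, x₁, hσ', hbot, Or.inl hA, ?_⟩
      have := h.reachable_of_same_top hτ hρ (by rw [hτσ, hρσ hσ.right_mem]) hv
        (by rw [hρ0]; exact Or.inl hA)
      simp only [hρ0] at this
      exact hr.trans this
    · rintro ⟨u', τ, y₁, y₀, hτ, hτσ, hv, hr⟩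
      obtain ⟨hy, huu⟩ := hσ.level_eq hτ hσ.left_mem hτ.right_mem hτσ.symm
      subst hy
      rcases hσ.nonneg.eq_or_lt with h0 | hpos
      · -- at a zero, there is nothing left below
        have e1 : y₁ = x₁ := le_antisymm hτ.le (h0 ▸ hτ.nonneg)
        subst e1
        have hv' : σ y₁ ∈ vertexSet f A := by rwa [← hτσ]
        refine ⟨u, σ, y₁, x₀, hσ, rfl, hv', ?_⟩
        simpa only [hτσ] using hr
      · obtain rfl := huu hpos
        obtain ⟨ρ, hρ, hρτ, hρσ⟩ := hτ.trans hσ hτσ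
        have hρ1 : ρ y₁ = τ y₁ := hρτ hτ.left_mem
        refine ⟨u, ρ, y₁, x₀, hρ, hρσ hσ.right_mem, by rwa [hρ1], ?_⟩
        simpa only [hρ1] using hr
  have hmem : ∀ z : vertexSet f A, ∃ u, IsRayLift f u (fun _ => (z : ℂ)) ‖f z‖ ‖f z‖ := by
    intro z
    obtain ⟨u, hu, hzu⟩ := Complex.exists_eq_norm_mul (z := f z)
    refine ⟨u, hu, norm_nonneg _, le_rfl, continuousOn_const,
      fun _ _ => h.vertexSet_subset z.2, fun x hx => ?_⟩
    rw [Icc_self, mem_singleton_iff] at hx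
    rw [hx]
    exact hzu
  have hvW : (v : ℂ) ∈ W := by
    obtain ⟨u, hu⟩ := hmem v
    exact ⟨u, _, _, _, hu, rfl, v.2, SimpleGraph.Reachable.refl _⟩
  obtain ⟨u, τ, y₁, y₀, hτ, hτw, hv, hr⟩ := (h.mem_iff_of_descent_invariant hinv
    (h.vertexSet_subset v.2) (h.vertexSet_subset w.2)).1 hvW
  have hw' : τ y₀ ∈ vertexSet f A := hτw ▸ w.2
  have := h.reachable_of_isRayLift hτ hw' hv
  have hwe : (⟨τ y₀, hw'⟩ : vertexSet f A) = w := Subtype.ext hτw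
  rw [hwe] at this
  exact hr.trans this.symm

end IsProperDiskMap
end Graph

/-! ### Counting edges -/

section Count
open Filter Topology

variable {f : ℂ → ℂ} {A : Set ℂ} {u v : ℂ} {σ τ : ℝ → ℂ} {x₁ x₀ y₁ y₀ : ℝ}

namespace IsProperDiskMap

/-- Near its upper end `β`, an edge runs along one of the `k` curves `w ^ k = 1 - x / |f β|`,
`w / (1 - x / |f β|) ^ (1 / k) = ζ`, of the power chart at `β`. -/
theorem exists_germ (h : IsProperDiskMap f A) (hσ : IsEdgeLift f A u σ x₁ x₀) {β : ℂ} {k : ℕ}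
    {φ : OpenPartialHomeomorph ℂ ℂ} {r : ℝ} (hφ : IsPowChart f β (-f β) k φ r)
    (hsub : φ.source ⊆ ball 0 1) (hβ : σ x₀ = β) :
    ∃ ζ : ℂ, ζ ^ k = 1 ∧ ∃ x < x₀, ∀ t ∈ Ioo x x₀, t ∈ Ioo x₁ x₀ ∧
      σ t = φ.symm (((1 - t / x₀) ^ ((k : ℝ)⁻¹) : ℝ) * ζ) := by
  subst hβ
  have hpos : 0 < x₀ := hσ.nonneg.trans_lt hσ.lt
  have hcw : Tendsto σ (𝓝[Ioo x₁ x₀] x₀) (𝓝 (σ x₀)) :=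
    ((hσ.continuousOn x₀ hσ.right_mem).mono Ioo_subset_Icc_self)
  have : (𝓝[Ioo x₁ x₀] x₀).NeBot := by
    rw [← mem_closure_iff_nhdsWithin_neBot, closure_Ioo hσ.lt.ne]
    exact hσ.right_mem
  obtain ⟨x, ⟨hxs, hxr⟩, hx⟩ :=
    ((hcw.eventually hφ.eventually_norm_lt).and self_mem_nhdsWithin).exists
  have hxI := Ioo_subset_Icc_self hx
  have hx0 : 0 ≤ x := hσ.nonneg.trans hx.1.le
  have hcone := hφ.isRayLift_cone hsub hxs hxr.le hσ.norm_dir (hσ.lift x hxI)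
    (hσ.lift x₀ hσ.right_mem) hx.2.ne hx0 hx.2.le (IsPowChart.mapsTo_unit hx.2)
  have heq := h.eqOn_of_isPreconnected hσ.toIsRayLift hcone (isPreconnected_Ico (a := x) (b := x₀))
    (Ico_subset_Icc_self.trans (Icc_subset_Icc_left hx.1.le)) Ico_subset_Icc_self
    (fun t ht => hσ.interior t ⟨hx.1.trans_le ht.1, ht.2⟩) (left_mem_Ico.2 hx.2)
    (by simp [div_self (sub_neg.2 hx.2).ne, IsPowChart.cone_one hxs])
  set s : ℝ := 1 - x / x₀ with hs
  have hs0 : 0 < s := by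
    rw [hs, sub_pos, div_lt_one hpos]
    exact hx.2
  have hφk : φ (σ x) ^ k = s := by
    have h1 := hφ.eq_pow _ hxs
    rw [hσ.lift x hxI, hσ.lift x₀ hσ.right_mem] at h1
    have hu := hσ.dir_ne_zero
    have h2 : (x₀ : ℂ) ≠ 0 := by exact_mod_cast hpos.ne'
    rw [hs]
    push_cast
    field_simp
    refine mul_right_cancel₀ hu ?_
    linear_combination h1
  have hsp : (((s ^ ((k : ℝ)⁻¹) : ℝ)) : ℂ) ≠ 0 := by
    exact_mod_cast (Real.rpow_pos_of_pos hs0 _).ne'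
  refine ⟨φ (σ x) / (s ^ ((k : ℝ)⁻¹) : ℝ), ?_, x, hx.2, fun t ht => ⟨⟨hx.1.trans ht.1, ht.2⟩, ?_⟩⟩
  · rw [div_pow, hφk, ← Complex.ofReal_pow, Real.rpow_inv_natCast_pow hs0.le hφ.ne_zero]
    exact div_self (by exact_mod_cast hs0.ne')
  · rw [heq (Ioo_subset_Ico_self ht)]
    change φ.symm _ = _
    congr 1
    have h1 : (t - x₀) / (x - x₀) = (1 - t / x₀) / s := by
      rw [hs]
      have := (sub_neg.2 hx.2).ne
      have : x₀ - x ≠ 0 := (sub_pos.2 hx.2).ne'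
      field_simp
      ring
    have h2 : 0 ≤ 1 - t / x₀ := by
      rw [sub_nonneg, div_le_one hpos]
      exact ht.2.le
    rw [h1, Real.div_rpow h2 hs0.le]
    push_cast
    field_simp

/-- An edge that goes down from `β` is determined by its direction at `β`, for which there are as
many possibilities as the order of `f - f β` at `β`. -/
theorem encard_edgeCurves_le (h : IsProperDiskMap f A) (hfin : (criticalSet f A).Finite) :
    (edgeCurves f A).encard ≤
      (∑ β ∈ hfin.toFinset, analyticOrderNatAt (fun z => f z - f β) β : ℕ) := by
  have hchart : ∀ β : criticalSet f A, ∃ φ r,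
      IsPowChart f β (-f β) (analyticOrderNatAt (fun z => f z - f β) β) φ r ∧
        φ.source ⊆ ball 0 1 := by
    rintro ⟨β, hβ⟩
    obtain ⟨k, hk⟩ := h.exists_order hβ.1
    have hfβ : -f β ≠ 0 := neg_ne_zero.2 fun h0 => hβ.2.1 ((h.mem_zeros β).2 ⟨hβ.1, h0⟩)
    have : analyticOrderNatAt (fun z => f z - f β) β = k := by
      rw [analyticOrderNatAt, hk, ENat.toNat_natCast]
    simp only [this]
    exact (h.analyticAt hβ.1).exists_isPowChart hfβ hk (isOpen_ball.mem_nhds hβ.1)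
  choose φ r hφ hsub using hchart
  set k : ℂ → ℕ := fun β => analyticOrderNatAt (fun z => f z - f β) β with hk
  have hcurve : ∀ C : edgeCurves f A, ∃ p : criticalSet f A × ℂ, p.2 ^ k p.1 = 1 ∧
      ∃ u σ x₁, IsEdgeLift f A u σ x₁ ‖f p.1‖ ∧ σ '' Icc x₁ ‖f p.1‖ = C ∧
        ∃ x < ‖f p.1‖, ∀ t ∈ Ioo x ‖f p.1‖, t ∈ Ioo x₁ ‖f p.1‖ ∧
          σ t = (φ p.1).symm (((1 - t / ‖f p.1‖) ^ ((k p.1 : ℝ)⁻¹) : ℝ) * p.2) := by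
    rintro ⟨C, γ, a, b, hγ, rfl⟩
    obtain ⟨u, σ, x₁, x₀, hσ, -, -, him⟩ := hγ.exists_isEdgeLift h
    have hβ := hσ.source_mem h
    have hx₀ : ‖f (σ x₀)‖ = x₀ := hσ.norm_eq hσ.right_mem
    obtain ⟨ζ, hζ, x, hx, hgerm⟩ := h.exists_germ hσ (hφ ⟨σ x₀, hβ⟩) (hsub _) rfl
    refine ⟨(⟨σ x₀, hβ⟩, ζ), hζ, u, σ, x₁, ?_⟩
    simp only [hx₀]
    exact ⟨hσ, him, x, hx, hgerm⟩
  choose p hp1 hp using hcurve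
  have hpinj : Function.Injective p := by
    intro C C' he
    obtain ⟨u, σ, x₁, hσ, hC, x, hx, hg⟩ := hp C
    obtain ⟨u', σ', x₁', hσ', hC', x', hx', hg'⟩ := hp C'
    rw [← he] at hσ' hC' hx' hg'
    obtain ⟨t, ht⟩ := nonempty_Ioo.2 (max_lt hx hx')
    obtain ⟨htI, ht1⟩ := hg t ⟨(le_max_left _ _).trans_lt ht.1, ht.2⟩
    obtain ⟨htI', ht2⟩ := hg' t ⟨(le_max_right _ _).trans_lt ht.1, ht.2⟩
    apply Subtype.ext
    rw [← hC, ← hC']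
    exact h.edgeLift_eq hσ hσ' ⟨t, Ioo_subset_Icc_self htI, rfl⟩
      ⟨t, Ioo_subset_Icc_self htI', ht2.trans ht1.symm⟩ (hσ.interior t htI)
  classical
  set T : Finset (Σ _ : ℂ, ℂ) := hfin.toFinset.sigma fun β =>
    (Polynomial.nthRoots (k β) (1 : ℂ)).toFinset with hT
  have hcard : T.card ≤ ∑ β ∈ hfin.toFinset, k β := by
    rw [hT, Finset.card_sigma]
    exact Finset.sum_le_sum fun β _ => (Multiset.toFinset_card_le _).trans
      (Polynomial.card_nthRoots _ _)
  set g : edgeCurves f A → Σ _ : ℂ, ℂ := fun C => ⟨(p C).1, (p C).2⟩ with hg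
  have hginj : Function.Injective g := by
    intro C C' he
    simp only [hg, Sigma.mk.injEq, heq_eq_eq] at he
    exact hpinj (Prod.ext (Subtype.ext he.1) he.2)
  have hgT : ∀ C, g C ∈ (T : Set (Σ _ : ℂ, ℂ)) := by
    intro C
    rw [Finset.mem_coe, hT, Finset.mem_sigma]
    refine ⟨hfin.mem_toFinset.2 (p C).1.2, ?_⟩
    rw [Multiset.mem_toFinset, Polynomial.mem_nthRoots
      (Nat.pos_of_ne_zero (hφ (p C).1).ne_zero)]
    exact hp1 C
  calc (edgeCurves f A).encard = (Set.range g).encard := by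
        rw [← image_univ, hginj.encard_image, encard_univ, encard]
    _ ≤ (T : Set (Σ _ : ℂ, ℂ)).encard := encard_le_encard (range_subset_iff.2 hgT)
    _ = (T.card : ℕ∞) := encard_coe_eq_coe_finsetCard T
    _ ≤ _ := by exact_mod_cast hcard

/-- When the orders of the critical points add up to at most one less than the number of vertices,
the connected graph of edges has no room for cycles or multiple edges. -/
theorem isTree_of_sum_order_le (h : IsProperDiskMap f A) (hfin : (criticalSet f A).Finite)
    (hsum : ∑ β ∈ hfin.toFinset, analyticOrderNatAt (fun z => f z - f β) β + 1 ≤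
      (vertexSet f A).ncard) :
    (descentGraph f A).IsTree ∧
    (edgeCurves f A).encard + 1 = (vertexSet f A).encard ∧
    (∀ (γ₁ γ₂ : ℝ → ℂ) (a₁ b₁ a₂ b₂ : ℝ),
      IsEdgePath f A γ₁ a₁ b₁ → IsEdgePath f A γ₂ a₂ b₂ → γ₁ a₁ = γ₂ a₂ → γ₁ b₁ = γ₂ b₂ →
      γ₁ '' Icc a₁ b₁ = γ₂ '' Icc a₂ b₂) := by
  have hVfin : Finite (vertexSet f A) := h.finite_vertexSet
  have hle := h.encard_edgeCurves_le hfin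
  have hEfin : (edgeCurves f A).Finite := finite_of_encard_le_coe hle
  have hEfin' : Finite (edgeCurves f A) := hEfin
  have hncard : (edgeCurves f A).ncard ≤
      ∑ β ∈ hfin.toFinset, analyticOrderNatAt (fun z => f z - f β) β := by
    rw [← hEfin.cast_ncard_eq] at hle
    exact_mod_cast hle
  have hconn := h.connected
  -- the edge curve that draws a given edge of the graph
  have hdraw : ∀ e : (descentGraph f A).edgeSet, ∃ C : edgeCurves f A, ∃ u σ x₁ x₀,
      IsEdgeLift f A u σ x₁ x₀ ∧ σ '' Icc x₁ x₀ = C ∧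
        e.1.map Subtype.val = s(σ x₀, σ x₁) := by
    rintro ⟨e, he⟩
    induction e with | _ v w
    rw [SimpleGraph.mem_edgeSet, descentGraph, SimpleGraph.fromRel_adj] at he
    rcases he.2 with ⟨γ, a, b, hγ, ha, hb⟩ | ⟨γ, a, b, hγ, ha, hb⟩
    · obtain ⟨u, σ, x₁, x₀, hσ, h0, h1, him⟩ := hγ.exists_isEdgeLift h
      exact ⟨⟨_, γ, a, b, hγ, rfl⟩, u, σ, x₁, x₀, hσ, him, by simp [h0, h1, ha, hb]⟩
    · obtain ⟨u, σ, x₁, x₀, hσ, h0, h1, him⟩ := hγ.exists_isEdgeLift h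
      exact ⟨⟨_, γ, a, b, hγ, rfl⟩, u, σ, x₁, x₀, hσ, him, by simp [h0, h1, ha, hb, Sym2.eq_swap]⟩
  choose D hD using hdraw
  have hDinj : Function.Injective D := by
    intro e e' he
    obtain ⟨u, σ, x₁, x₀, hσ, hC, hm⟩ := hD e
    obtain ⟨u', σ', x₁', x₀', hσ', hC', hm'⟩ := hD e'
    obtain ⟨h0, h1⟩ := hσ.endpoints_eq hσ'.toIsRayLift (by rw [hC, hC', he])
    refine Subtype.ext (Sym2.map.injective Subtype.val_injective ?_)
    rw [hm, hm', h0, h1]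
  have hcard1 : Nat.card (descentGraph f A).edgeSet ≤ Nat.card (edgeCurves f A) :=
    Nat.card_le_card_of_injective D hDinj
  have hcard2 := hconn.card_vert_le_card_edgeSet_add_one
  rw [Nat.card_coe_set_eq] at hcard2
  rw [Nat.card_coe_set_eq (edgeCurves f A)] at hcard1
  have hE : Nat.card (descentGraph f A).edgeSet = (edgeCurves f A).ncard := by omega
  have hV : (edgeCurves f A).ncard + 1 = (vertexSet f A).ncard := by omega
  have hDsurj : Function.Surjective D :=
    ((Nat.bijective_iff_injective_and_card D).2 ⟨hDinj, by rw [hE, Nat.card_coe_set_eq]⟩).2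
  refine ⟨?_, ?_, ?_⟩
  · rw [SimpleGraph.isTree_iff_connected_and_card]
    exact ⟨hconn, by rw [hE, hV, Nat.card_coe_set_eq]⟩
  · rw [← hEfin.cast_ncard_eq, ← h.finite_vertexSet.cast_ncard_eq]
    exact_mod_cast hV
  · intro γ₁ γ₂ a₁ b₁ a₂ b₂ hγ₁ hγ₂ ha hb
    have key : ∀ {γ : ℝ → ℂ} {a b : ℝ}, IsEdgePath f A γ a b →
        ∃ e : (descentGraph f A).edgeSet, (D e : Set ℂ) = γ '' Icc a b ∧
          e.1.map Subtype.val = s(γ a, γ b) := by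
      intro γ a b hγ
      obtain ⟨e, he⟩ := hDsurj ⟨_, γ, a, b, hγ, rfl⟩
      obtain ⟨u, σ, x₁, x₀, hσ, hC, hm⟩ := hD e
      obtain ⟨u', σ', x₁', x₀', hσ', h0', h1', him⟩ := hγ.exists_isEdgeLift h
      obtain ⟨h0, h1⟩ := hσ.endpoints_eq hσ'.toIsRayLift (by rw [hC, him, he])
      exact ⟨e, by rw [he], by rw [hm, h0, h1, h0', h1']⟩
    obtain ⟨e₁, h₁, m₁⟩ := key hγ₁
    obtain ⟨e₂, h₂, m₂⟩ := key hγ₂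
    have : e₁ = e₂ := Subtype.ext (Sym2.map.injective Subtype.val_injective
      (by rw [m₁, m₂, ha, hb]))
    rw [← h₁, ← h₂, this]

end IsProperDiskMap
end Count

/-! ### Crofton's bound on lengths -/

section Crofton
open Filter Topology MeasureTheory

/-- A continuous function with values in `[-1, 1]` that takes almost every value at most `M` times
has variation at most `2 * M`: almost every level is crossed at most `M` times. -/
theorem sum_abs_sub_le_of_encard_fiber_le {g : ℝ → ℝ} {a b : ℝ} {M : ℕ}
    (hg : ContinuousOn g (Icc a b)) (hg1 : MapsTo g (Icc a b) (Icc (-1) 1))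
    (hM : ∀ᵐ x, {t | t ∈ Icc a b ∧ g t = x}.encard ≤ M) {t : ℕ → ℝ} (ht : Monotone t)
    (hmem : ∀ i, t i ∈ Icc a b) (m : ℕ) :
    ∑ i ∈ Finset.range m, |g (t (i + 1)) - g (t i)| ≤ 2 * M := by
  classical
  set I : ℕ → Set ℝ := fun i => Ioo (min (g (t i)) (g (t (i + 1)))) (max (g (t i)) (g (t (i + 1))))
    with hI
  -- each level in `I i` is taken at some parameter strictly between `t i` and `t (i + 1)`
  have hivt : ∀ i, ∀ x ∈ I i, ∃ s ∈ Ioo (t i) (t (i + 1)), g s = x := by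
    intro i x hx
    have hle := ht (Nat.le_add_right i 1)
    have hsub : Icc (t i) (t (i + 1)) ⊆ Icc a b := Icc_subset_Icc (hmem i).1 (hmem (i + 1)).2
    rcases le_total (g (t i)) (g (t (i + 1))) with h | h
    · simp only [hI, min_eq_left h, max_eq_right h] at hx
      exact intermediate_value_Ioo hle (hg.mono hsub) hx
    · simp only [hI, min_eq_right h, max_eq_left h] at hx
      exact intermediate_value_Ioo' hle (hg.mono hsub) hx
  have hsub : ∀ i, I i ⊆ Icc (-1) 1 := fun i x hx =>
    ⟨(le_min (hg1 (hmem i)).1 (hg1 (hmem _)).1).trans hx.1.le,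
      hx.2.le.trans (max_le (hg1 (hmem i)).2 (hg1 (hmem _)).2)⟩
  have hpt : ∀ᵐ x, ∑ i ∈ Finset.range m, (I i).indicator (fun _ => (1 : ENNReal)) x ≤
      (Icc (-1 : ℝ) 1).indicator (fun _ => (M : ENNReal)) x := by
    filter_upwards [hM] with x hx
    have hsum : ∑ i ∈ Finset.range m, (I i).indicator (fun _ => (1 : ENNReal)) x =
        (((Finset.range m).filter fun i => x ∈ I i).card : ENNReal) := by
      rw [Finset.card_filter]
      push_cast
      exact Finset.sum_congr rfl fun i _ => by simp [indicator]
    rw [hsum]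
    by_cases hx1 : x ∈ Icc (-1 : ℝ) 1
    · rw [indicator_of_mem hx1]
      have hchoose : ∀ i, ∃ s, x ∈ I i → s ∈ Ioo (t i) (t (i + 1)) ∧ g s = x := fun i => by
        by_cases h : x ∈ I i
        · obtain ⟨s, hs⟩ := hivt i x h
          exact ⟨s, fun _ => hs⟩
        · exact ⟨0, fun h' => absurd h' h⟩
      choose s hs using hchoose
      have hinj : InjOn s {i | x ∈ I i} := by
        have key : ∀ i j, x ∈ I i → x ∈ I j → i < j → s i < s j := fun i j hi hj hij =>
          ((hs i hi).1.2.trans_le (ht hij)).trans (hs j hj).1.1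
        intro i hi j hj hij
        rcases lt_trichotomy i j with h | h | h
        · exact absurd hij (key i j hi hj h).ne
        · exact h
        · exact absurd hij (key j i hj hi h).ne'
      have hcard : (((Finset.range m).filter fun i => x ∈ I i : Finset ℕ) : Set ℕ).encard ≤ M := by
        refine le_trans (encard_le_encard_of_injOn (f := s) (fun i hi => ?_)
          (hinj.mono fun i hi => ?_)) hx
        · have hi' := (Finset.mem_filter.1 hi).2
          have := hs i hi'
          exact ⟨⟨(hmem i).1.trans this.1.1.le, this.1.2.le.trans (hmem _).2⟩, this.2⟩
        · exact (Finset.mem_filter.1 hi).2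
      rw [encard_coe_eq_coe_finsetCard] at hcard
      exact_mod_cast hcard
    · have : ((Finset.range m).filter fun i => x ∈ I i) = ∅ :=
        Finset.filter_eq_empty_iff.2 fun i _ hi => hx1 (hsub i hi)
      simp [this]
  have hlin : ENNReal.ofReal (∑ i ∈ Finset.range m, |g (t (i + 1)) - g (t i)|) ≤
      ENNReal.ofReal (2 * M) := by
    calc ENNReal.ofReal (∑ i ∈ Finset.range m, |g (t (i + 1)) - g (t i)|)
        = ∑ i ∈ Finset.range m, volume (I i) := by
          rw [ENNReal.ofReal_sum_of_nonneg fun _ _ => abs_nonneg _]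
          refine Finset.sum_congr rfl fun i _ => ?_
          rw [hI, Real.volume_Ioo, max_sub_min_eq_abs']
          rw [abs_sub_comm]
      _ = ∑ i ∈ Finset.range m, ∫⁻ x, (I i).indicator (fun _ => (1 : ENNReal)) x := by
          refine Finset.sum_congr rfl fun i _ => ?_
          rw [lintegral_indicator measurableSet_Ioo, setLIntegral_one]
      _ = ∫⁻ x, ∑ i ∈ Finset.range m, (I i).indicator (fun _ => (1 : ENNReal)) x :=
          (lintegral_finsetSum _ fun i _ => measurable_const.indicator measurableSet_Ioo).symm
      _ ≤ ∫⁻ x, (Icc (-1 : ℝ) 1).indicator (fun _ => (M : ENNReal)) x := lintegral_mono_ae hpt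
      _ = ENNReal.ofReal (2 * M) := by
          rw [lintegral_indicator measurableSet_Icc, setLIntegral_const, Real.volume_Icc,
            ENNReal.ofReal_mul (by norm_num), mul_comm]
          norm_num
  exact (ENNReal.ofReal_le_ofReal_iff (by positivity)).1 hlin

/-- The coordinate of `z` in the direction `exp (φ * I)`. -/
noncomputable def dirCoord (φ : ℝ) (z : ℂ) : ℝ := z.re * Real.cos φ + z.im * Real.sin φ

/-- The length of a vector is the average of the lengths of its projections, up to a factor. -/
theorem norm_eq_integral_dirCoord (z : ℂ) :
    ‖z‖ = (1 / 2) * ∫ φ in (0 : ℝ)..Real.pi, |dirCoord φ z| := by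
  have h1 : ∀ φ, |dirCoord φ z| = ‖z‖ * |Real.cos (φ - z.arg)| := by
    intro φ
    have h : ‖z‖ * |Real.cos (φ - z.arg)| = |‖z‖ * Real.cos (φ - z.arg)| := by
      rw [abs_mul, abs_of_nonneg (norm_nonneg z)]
    rw [h, dirCoord, Real.cos_sub]
    congr 1
    nth_rewrite 1 [← Complex.norm_mul_cos_arg z]
    nth_rewrite 1 [← Complex.norm_mul_sin_arg z]
    ring
  have hper : Function.Periodic (fun φ => |Real.cos φ|) Real.pi := fun φ => by
    simp [Real.cos_add_pi]
  have h2 : ∫ φ in (0 : ℝ)..Real.pi, |Real.cos (φ - z.arg)| = 2 := by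
    rw [intervalIntegral.integral_comp_sub_right (fun φ => |Real.cos φ|)]
    have := hper.intervalIntegral_add_eq (0 - z.arg) (-(Real.pi / 2))
    rw [show Real.pi - z.arg = 0 - z.arg + Real.pi by ring, this,
      show -(Real.pi / 2) + Real.pi = Real.pi / 2 by ring]
    have hpi := Real.pi_pos
    rw [intervalIntegral.integral_congr (g := Real.cos) fun φ hφ => ?_]
    · rw [integral_cos]
      simp
      norm_num
    · rw [uIcc_of_le (by linarith)] at hφ
      exact abs_of_nonneg (Real.cos_nonneg_of_mem_Icc hφ)
  simp only [h1]
  rw [intervalIntegral.integral_const_mul, h2]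
  ring

/-- **Crofton's bound**: a curve in the unit disk that, for each direction, meets almost every line
in that direction at most `M` times has length at most `π * M`. -/
theorem eVariationOn_le_of_encard_line_le {γ : ℝ → ℂ} {a b : ℝ} {M : ℕ}
    (hγ : ContinuousOn γ (Icc a b)) (hball : ∀ t ∈ Icc a b, γ t ∈ closedBall (0 : ℂ) 1)
    (hM : ∀ φ, ∀ᵐ x, {t | t ∈ Icc a b ∧ dirCoord φ (γ t) = x}.encard ≤ M) :
    eVariationOn γ (Icc a b) ≤ ENNReal.ofReal (Real.pi * M) := by
  refine iSup_le ?_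
  rintro ⟨m, t, ht, hmem⟩
  have hcont : ∀ z, Continuous fun φ => |dirCoord φ z| := fun z => by
    unfold dirCoord
    fun_prop
  have hle : ∀ φ, ∑ i ∈ Finset.range m, |dirCoord φ (γ (t (i + 1)) - γ (t i))| ≤ 2 * M := by
    intro φ
    have hd : ∀ z w, dirCoord φ (z - w) = dirCoord φ z - dirCoord φ w := fun z w => by
      simp only [dirCoord, Complex.sub_re, Complex.sub_im]
      ring
    simp only [hd]
    refine sum_abs_sub_le_of_encard_fiber_le (g := fun s => dirCoord φ (γ s)) ?_ ?_ (hM φ) ht hmem m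
    · have : Continuous (dirCoord φ) := by
        unfold dirCoord
        fun_prop
      exact this.comp_continuousOn hγ
    · intro s hs
      have h1 : ‖γ s‖ ≤ 1 := by simpa using hball s hs
      have h2 : (γ s).re ^ 2 + (γ s).im ^ 2 ≤ 1 := by
        have := Complex.sq_norm (γ s)
        rw [Complex.normSq_apply] at this
        nlinarith [norm_nonneg (γ s)]
      have h3 := Real.sin_sq_add_cos_sq φ
      have h4 : dirCoord φ (γ s) ^ 2 ≤ 1 := by
        unfold dirCoord
        nlinarith [sq_nonneg ((γ s).re * Real.sin φ - (γ s).im * Real.cos φ)]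
      exact abs_le.1 (by
        rw [← sq_abs] at h4
        nlinarith [abs_nonneg (dirCoord φ (γ s))])
  have hsum : ∑ i ∈ Finset.range m, ‖γ (t (i + 1)) - γ (t i)‖ ≤ Real.pi * M := by
    calc ∑ i ∈ Finset.range m, ‖γ (t (i + 1)) - γ (t i)‖
        = (1 / 2) * ∫ φ in (0 : ℝ)..Real.pi,
            ∑ i ∈ Finset.range m, |dirCoord φ (γ (t (i + 1)) - γ (t i))| := by
          rw [intervalIntegral.integral_finsetSum fun i _ => (hcont _).intervalIntegrable _ _,
            Finset.mul_sum]
          exact Finset.sum_congr rfl fun i _ => norm_eq_integral_dirCoord _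
      _ ≤ (1 / 2) * ∫ _φ in (0 : ℝ)..Real.pi, (2 * M : ℝ) := by
          gcongr
          refine intervalIntegral.integral_mono_on Real.pi_pos.le
            ((continuous_finsetSum _ fun i _ => hcont _).intervalIntegrable _ _)
            (by simp) fun φ _ => hle φ
      _ = Real.pi * M := by
          rw [intervalIntegral.integral_const]
          simp
          ring
  calc ∑ i ∈ Finset.range m, edist (γ (t (i + 1))) (γ (t i))
      = ENNReal.ofReal (∑ i ∈ Finset.range m, ‖γ (t (i + 1)) - γ (t i)‖) := by
        rw [ENNReal.ofReal_sum_of_nonneg fun _ _ => norm_nonneg _]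
        exact Finset.sum_congr rfl fun i _ => by rw [edist_dist, dist_eq_norm]
    _ ≤ _ := ENNReal.ofReal_le_ofReal hsum

end Crofton

/-! ### Intersections with lines -/

section LineCount
open Filter Topology MeasureTheory Polynomial
open scoped ComplexConjugate

/-- For polynomials `P`, `Q` and a direction `u`, the polynomial in the real variable `s` given by
`2 * I * Im (conj u * P z * conj (Q z))` at `z = p + s * v`. Its real zeros are the points of the
line where the value of `P / Q` lies on the line spanned by `u`. -/
noncomputable def linePolynomial (P Q : ℂ[X]) (u p v : ℂ) : ℂ[X] :=
  C (conj u) * P.comp (C p + C v * X) * (Q.comp (C p + C v * X)).map (starRingEnd ℂ) -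
    (C (conj u) * P.comp (C p + C v * X) *
      (Q.comp (C p + C v * X)).map (starRingEnd ℂ)).map (starRingEnd ℂ)

theorem Polynomial.eval_map_conj_ofReal (P : ℂ[X]) (s : ℝ) :
    (P.map (starRingEnd ℂ)).eval (s : ℂ) = conj (P.eval (s : ℂ)) := by
  conv_lhs => rw [← Complex.conj_ofReal s]
  exact eval_map_apply _ _

theorem eval_linePolynomial (P Q : ℂ[X]) (u p v : ℂ) (s : ℝ) :
    (linePolynomial P Q u p v).eval (s : ℂ) =
      (2 * (conj u * P.eval (p + v * s) * conj (Q.eval (p + v * s))).im : ℝ) * Complex.I := by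
  rw [linePolynomial, eval_sub, eval_map_conj_ofReal, eval_mul, eval_map_conj_ofReal]
  simp only [eval_mul, eval_comp, eval_C, eval_add, eval_X]
  exact Complex.sub_conj _

theorem natDegree_linePolynomial_le {P Q : ℂ[X]} {N : ℕ} (hP : P.natDegree ≤ N)
    (hQ : Q.natDegree ≤ N) (u p v : ℂ) : (linePolynomial P Q u p v).natDegree ≤ 2 * N := by
  have hlin : (C p + C v * X).natDegree ≤ 1 := by
    refine natDegree_add_le_of_degree_le (by simp) ?_
    exact (natDegree_C_mul_le _ _).trans natDegree_X_le
  have hcomp : ∀ R : ℂ[X], R.natDegree ≤ N → (R.comp (C p + C v * X)).natDegree ≤ N := by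
    intro R hR
    refine natDegree_comp_le.trans ?_
    calc R.natDegree * (C p + C v * X).natDegree ≤ N * 1 := Nat.mul_le_mul hR hlin
      _ = N := mul_one N
  have hF : (C (conj u) * P.comp (C p + C v * X) *
      (Q.comp (C p + C v * X)).map (starRingEnd ℂ)).natDegree ≤ 2 * N := by
    refine natDegree_mul_le.trans ?_
    have h1 := (natDegree_C_mul_le (conj u) (P.comp (C p + C v * X))).trans (hcomp P hP)
    have h2 := (natDegree_map_le (f := starRingEnd ℂ) (p := Q.comp (C p + C v * X))).trans
      (hcomp Q hQ)
    omega
  exact (natDegree_sub_le _ _).trans (max_le hF (natDegree_map_le.trans hF))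

/-- A polynomial with infinitely many real zeros vanishes. -/
theorem Polynomial.eq_zero_of_infinite_real {F : ℂ[X]}
    (h : {s : ℝ | F.eval (s : ℂ) = 0}.Infinite) :
    F = 0 := by
  refine eq_zero_of_infinite_isRoot F ((h.image Complex.ofReal_injective.injOn).mono ?_)
  rintro _ ⟨s, hs, rfl⟩
  exact hs

variable {f : ℂ → ℂ} {A : Set ℂ}

/-- A proper self-map of the disk does not map the disk into a line through the origin. -/
theorem IsProperDiskMap.exists_im_ne_zero (h : IsProperDiskMap f A) {u : ℂ} (hu : ‖u‖ = 1) :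
    ∃ z ∈ ball (0 : ℂ) 1, (conj u * f z).im ≠ 0 := by
  obtain ⟨_, σ, hσ, -, hA⟩ := h.exists_isRayLift_zero (z := 0) (by simp)
  obtain ⟨hz, hf⟩ := (h.mem_zeros _).1 hA
  have hu0 : u ≠ 0 := by rintro rfl; simp at hu
  obtain ⟨k, φ, r, hφ, hsub⟩ := h.exists_isPowChart hz (mul_ne_zero Complex.I_ne_zero hu0)
  have hrt : (r : ℂ) ∈ φ.target := hφ.closedBall_subset (by
    rw [mem_closedBall_zero_iff, Complex.norm_real, Real.norm_of_nonneg hφ.pos.le])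
  refine ⟨φ.symm r, hsub (φ.map_target hrt), ?_⟩
  have hval : conj u * f (φ.symm r) = ((r ^ k : ℝ) : ℂ) * Complex.I := by
    have huu : conj u * u = 1 := by rw [Complex.conj_mul', hu]; simp
    rw [hφ.eq_pow _ (φ.map_target hrt), φ.right_inv hrt, hf]
    push_cast
    linear_combination Complex.I * r ^ k * huu
  rw [hval, Complex.im_ofReal_mul, Complex.I_im, mul_one]
  exact (pow_pos hφ.pos k).ne'

/-- A path of steepest descent has length at most `2 * π * N` when `f` is a quotient of polynomials
of degree at most `N`: it lies in the algebraic curve `Im (conj u * P * conj Q) = 0`, which meets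
all but finitely many lines of each direction in at most `2 * N` points. -/
theorem IsSteepestDescent.eVariationOn_le {γ : ℝ → ℂ} {a b : ℝ} {P Q : ℂ[X]} {N : ℕ}
    (hγ : IsSteepestDescent f γ a b) (h : IsProperDiskMap f A) (ha : γ a ∈ ball (0 : ℂ) 1)
    (hP : P.natDegree ≤ N) (hQ : Q.natDegree ≤ N)
    (hQ0 : ∀ z ∈ ball (0 : ℂ) 1, Q.eval z ≠ 0)
    (hf : ∀ z ∈ ball (0 : ℂ) 1, f z = P.eval z / Q.eval z) :
    eVariationOn γ (Icc a b) ≤ ENNReal.ofReal (2 * Real.pi * N) := by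
  obtain ⟨u, hu, hdir⟩ := hγ.exists_dir h ha
  have hball : ∀ t ∈ Icc a b, γ t ∈ ball (0 : ℂ) 1 := fun t ht => hγ.mem_ball h ha ht
  have hinj : InjOn γ (Icc a b) := fun s hs t ht hst =>
    hγ.decreasing.injOn hs ht (by simp only [hst])
  have hfP : ∀ z ∈ ball (0 : ℂ) 1, conj u * P.eval z * conj (Q.eval z) =
      ((‖Q.eval z‖ ^ 2 : ℝ) : ℂ) * (conj u * f z) := by
    intro z hz
    have := hQ0 z hz
    rw [hf z hz]
    push_cast
    rw [← Complex.mul_conj']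
    field_simp
  have hzero : ∀ t ∈ Icc a b, (conj u * P.eval (γ t) * conj (Q.eval (γ t))).im = 0 := by
    intro t ht
    rw [hfP _ (hball t ht), hdir t ht, mul_left_comm (conj u), Complex.conj_mul', hu]
    norm_cast
  have key : eVariationOn γ (Icc a b) ≤ ENNReal.ofReal (Real.pi * (2 * N : ℕ)) := by
    refine eVariationOn_le_of_encard_line_le hγ.continuousOn
      (fun t ht => ball_subset_closedBall (hball t ht)) fun φ => ?_
    set e : ℂ := Complex.exp (φ * Complex.I) with he
    have hre : ∀ z : ℂ, z = dirCoord φ z * e +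
        (z.im * Real.cos φ - z.re * Real.sin φ : ℝ) * (Complex.I * e) := by
      intro z
      have h1 : (Real.sin φ : ℝ) ^ 2 + Real.cos φ ^ 2 = 1 := Real.sin_sq_add_cos_sq φ
      rw [he, Complex.exp_mul_I, ← Complex.ofReal_cos, ← Complex.ofReal_sin, dirCoord]
      apply Complex.ext
      · simp [-Complex.ofReal_cos, -Complex.ofReal_sin]
        linear_combination -z.re * h1
      · simp [-Complex.ofReal_cos, -Complex.ofReal_sin]
        linear_combination -z.im * h1
    set G : ℝ → ℂ[X] := fun x => linePolynomial P Q u (x * e) (Complex.I * e) with hG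
    -- a polynomial in two variables that vanishes on infinitely many parallel lines is zero
    have hbad : {x : ℝ | G x = 0}.Finite := by
      by_contra hinf
      obtain ⟨z, hz, hne⟩ := h.exists_im_ne_zero hu
      set s : ℝ := z.im * Real.cos φ - z.re * Real.sin φ with hs
      have hzer : linePolynomial P Q u (s * (Complex.I * e)) e = 0 := by
        refine eq_zero_of_infinite_real (Set.Infinite.mono (fun x hx => ?_) hinf)
        have h1 : (G x).eval (s : ℂ) = 0 := by rw [show G x = 0 from hx, eval_zero]
        rw [hG, eval_linePolynomial] at h1
        rw [mem_ofPred_eq, eval_linePolynomial, ← h1]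
        ring_nf
      have h2 := eval_linePolynomial P Q u (s * (Complex.I * e)) e (dirCoord φ z)
      have h3 : (s : ℂ) * (Complex.I * e) + e * dirCoord φ z = z := by
        conv_rhs => rw [hre z]
        ring
      rw [hzer, eval_zero, h3, hfP z hz] at h2
      have h4 := (mul_eq_zero.1 h2.symm).resolve_right Complex.I_ne_zero
      rw [Complex.ofReal_eq_zero, Complex.im_ofReal_mul] at h4
      have h5 := norm_ne_zero_iff.2 (hQ0 z hz)
      exact mul_ne_zero two_ne_zero (mul_ne_zero (pow_ne_zero 2 h5) hne) h4
    have hae : ∀ᵐ x : ℝ, x ∉ {x : ℝ | G x = 0} := by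
      rw [ae_iff]
      simpa using hbad.measure_zero volume
    filter_upwards [hae] with x hx
    have hx0 : G x ≠ 0 := hx
    have hroots : ((G x).roots.toFinset : Set ℂ).encard ≤ (2 * N : ℕ) := by
      rw [encard_coe_eq_coe_finsetCard]
      exact_mod_cast (Multiset.toFinset_card_le _).trans ((card_roots' _).trans
        (natDegree_linePolynomial_le hP hQ _ _ _))
    refine le_trans (encard_le_encard_of_injOn (f := fun t =>
      (((γ t).im * Real.cos φ - (γ t).re * Real.sin φ : ℝ) : ℂ)) ?_ ?_) hroots
    · rintro t ⟨ht, htx⟩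
      rw [Finset.mem_coe, Multiset.mem_toFinset, mem_roots hx0, IsRoot, hG, eval_linePolynomial]
      have h1 : (x : ℂ) * e + Complex.I * e *
          (((γ t).im * Real.cos φ - (γ t).re * Real.sin φ : ℝ) : ℂ) = γ t := by
        conv_rhs => rw [hre (γ t), htx]
        ring
      rw [h1, hzero t ht]
      simp
    · rintro s ⟨hs, hsx⟩ t ⟨ht, htx⟩ hst
      refine hinj hs ht ?_
      rw [hre (γ s), hre (γ t), hsx, htx]
      simp only at hst
      rw [hst]
  refine key.trans (ENNReal.ofReal_le_ofReal (le_of_eq ?_))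
  push_cast
  ring

end LineCount

/-! ### Self-reciprocal polynomials -/

section Reciprocal
open Polynomial
open scoped ComplexConjugate

/-- The conjugate reciprocal `z ^ N * conj (p (1 / conj z))` of a polynomial of degree at most
`N`. -/
noncomputable def conjReflect (N : ℕ) (p : ℂ[X]) : ℂ[X] := (p.map (starRingEnd ℂ)).reflect N

theorem conjReflect_mul {p q : ℂ[X]} {M N : ℕ} (hp : p.natDegree ≤ M) (hq : q.natDegree ≤ N) :
    conjReflect (M + N) (p * q) = conjReflect M p * conjReflect N q := by
  rw [conjReflect, Polynomial.map_mul]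
  exact reflect_mul _ _ (natDegree_map_le.trans hp) (natDegree_map_le.trans hq)

theorem conjReflect_prod {ι : Type*} (s : Finset ι) (p : ι → ℂ[X]) {N : ℕ}
    (hp : ∀ i ∈ s, (p i).natDegree ≤ N) :
    conjReflect (N * s.card) (∏ i ∈ s, p i) = ∏ i ∈ s, conjReflect N (p i) := by
  classical
  induction s using Finset.induction_on with
  | empty => simp [conjReflect]
  | insert a s ha ih =>
    have hs : ∀ i ∈ s, (p i).natDegree ≤ N := fun i hi => hp i (Finset.mem_insert_of_mem hi)
    have hdeg : (∏ i ∈ s, p i).natDegree ≤ N * s.card :=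
      (natDegree_prod_le _ _).trans ((Finset.sum_le_card_nsmul _ _ _ hs).trans_eq
        (by rw [smul_eq_mul, mul_comm]))
    rw [Finset.prod_insert ha, Finset.prod_insert ha, Finset.card_insert_of_notMem ha,
      show N * (s.card + 1) = N + N * s.card by ring,
      conjReflect_mul (hp a (Finset.mem_insert_self _ _)) hdeg, ih hs]

theorem conjReflect_sum {ι : Type*} (s : Finset ι) (p : ι → ℂ[X]) (N : ℕ) :
    conjReflect N (∑ i ∈ s, p i) = ∑ i ∈ s, conjReflect N (p i) := by
  ext m
  simp [conjReflect, coeff_reflect, finsetSum_coeff]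

theorem conjReflect_C_mul (r : ℝ) (p : ℂ[X]) (N : ℕ) :
    conjReflect N (C (r : ℂ) * p) = C (r : ℂ) * conjReflect N p := by
  simp [conjReflect, reflect_C_mul]

theorem conjReflect_X_sub_C (α : ℂ) : conjReflect 1 (X - C α) = 1 - C (conj α) * X := by
  simp [conjReflect, reflect_sub, reflect_C]

theorem conjReflect_one_sub (α : ℂ) : conjReflect 1 (1 - C (conj α) * X) = X - C α := by
  simp [conjReflect, reflect_sub, reflect_C_mul, reflect_one]

theorem natDegree_one_sub_C_mul_X_le (α : ℂ) : (1 - C α * X : ℂ[X]).natDegree ≤ 1 := by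
  refine (natDegree_sub_le _ _).trans (max_le (by simp) ?_)
  exact (natDegree_C_mul_le _ _).trans natDegree_X_le

/-- The roots of a self-reciprocal polynomial come in pairs `β`, `1 / conj β`. -/
theorem rootMultiplicity_le_of_conjReflect_eq {R : ℂ[X]} {N : ℕ} (hR : R ≠ 0)
    (hdeg : R.natDegree ≤ N) (hself : conjReflect N R = R) {β : ℂ} (hβ : β ≠ 0) :
    R.rootMultiplicity β ≤ R.rootMultiplicity (conj β)⁻¹ := by
  rw [le_rootMultiplicity_iff hR]
  obtain ⟨H, hH⟩ := pow_rootMultiplicity_dvd R β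
  set m := R.rootMultiplicity β with hm
  have hH0 : H ≠ 0 := by
    rintro rfl
    exact hR (by rw [hH, mul_zero])
  have hXm : ((X - C β) ^ m).natDegree = m := by rw [natDegree_pow, natDegree_X_sub_C, mul_one]
  have hdH : m + H.natDegree ≤ N := by
    rw [hH, natDegree_mul (pow_ne_zero _ (X_sub_C_ne_zero β)) hH0, hXm] at hdeg
    exact hdeg
  have hpow : conjReflect m ((X - C β) ^ m) = (1 - C (conj β) * X) ^ m := by
    have := conjReflect_prod (Finset.range m) (fun _ => X - C β) (N := 1)
      (fun _ _ => natDegree_X_sub_C_le β)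
    simpa [conjReflect_X_sub_C] using this
  have hfac : R = (1 - C (conj β) * X) ^ m * conjReflect (N - m) H := by
    conv_lhs => rw [← hself, hH, show N = m + (N - m) by omega,
      conjReflect_mul hXm.le (by omega), hpow]
  have hcβ : conj β ≠ 0 := (_root_.map_ne_zero _).2 hβ
  have hlin : (1 - C (conj β) * X : ℂ[X]) = C (-conj β) * (X - C (conj β)⁻¹) := by
    rw [mul_sub, ← C_mul, neg_mul, mul_inv_cancel₀ hcβ, C_neg, C_neg, C_1]
    ring
  rw [hfac, hlin, mul_pow]
  exact (Dvd.intro_left _ rfl).mul_right _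

theorem sum_rootMultiplicity_le {R : ℂ[X]} (S : Finset ℂ) :
    ∑ β ∈ S, R.rootMultiplicity β ≤ R.natDegree := by
  classical
  calc ∑ β ∈ S, R.rootMultiplicity β
      ≤ ∑ β ∈ S ∪ R.roots.toFinset, R.rootMultiplicity β :=
        Finset.sum_le_sum_of_subset Finset.subset_union_left
    _ = ∑ β ∈ S ∪ R.roots.toFinset, R.roots.count β := by simp only [count_roots]
    _ = R.roots.card := Multiset.sum_count_eq_card fun a ha =>
        Finset.mem_union_right _ (Multiset.mem_toFinset.2 ha)
    _ ≤ R.natDegree := card_roots' R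

/-- At most half of the roots of a self-reciprocal polynomial lie in the punctured disk. -/
theorem two_mul_sum_rootMultiplicity_le {R : ℂ[X]} {N : ℕ} (hR : R ≠ 0)
    (hdeg : R.natDegree ≤ N) (hself : conjReflect N R = R) (B : Finset ℂ)
    (hB : ∀ β ∈ B, β ∈ ball (0 : ℂ) 1) (hB0 : (0 : ℂ) ∉ B) :
    2 * ∑ β ∈ B, R.rootMultiplicity β ≤ N := by
  classical
  have hne : ∀ β ∈ B, β ≠ 0 := fun β hβ h0 => hB0 (h0 ▸ hβ)
  set B' := B.image fun β => (conj β)⁻¹ with hB'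
  have hdisj : Disjoint B B' := by
    rw [Finset.disjoint_left]
    intro x hx hx'
    obtain ⟨β, hβ, rfl⟩ := Finset.mem_image.1 hx'
    have h1 := mem_ball_zero_iff.1 (hB _ hx)
    have h2 := mem_ball_zero_iff.1 (hB _ hβ)
    rw [norm_inv, RCLike.norm_conj] at h1
    exact absurd h1 (not_lt.2 (one_le_inv_iff₀.2 ⟨norm_pos_iff.2 (hne β hβ), h2.le⟩))
  have hsum : ∑ β ∈ B', R.rootMultiplicity β = ∑ β ∈ B, R.rootMultiplicity (conj β)⁻¹ :=
    Finset.sum_image fun x _ y _ hxy => (starRingEnd ℂ).injective (inv_injective hxy)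
  calc 2 * ∑ β ∈ B, R.rootMultiplicity β
      ≤ ∑ β ∈ B, R.rootMultiplicity β + ∑ β ∈ B', R.rootMultiplicity β := by
        rw [two_mul, hsum]
        gcongr with β hβ
        exact rootMultiplicity_le_of_conjReflect_eq hR hdeg hself (hne β hβ)
    _ = ∑ β ∈ B ∪ B', R.rootMultiplicity β := (Finset.sum_union hdisj).symm
    _ ≤ N := (sum_rootMultiplicity_le _).trans hdeg

theorem Polynomial.analyticOrderAt_eval {R : ℂ[X]} (hR : R ≠ 0) (β : ℂ) :
    analyticOrderAt (fun z => R.eval z) β = R.rootMultiplicity β := by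
  obtain ⟨H, hH, hHr⟩ := exists_eq_pow_rootMultiplicity_mul_and_not_dvd R hR β
  have ha : ∀ P : ℂ[X], AnalyticAt ℂ (fun z => P.eval z) β := fun P => by
    simpa using AnalyticAt.aeval_polynomial (analyticAt_id (𝕜 := ℂ) (z := β)) P
  rw [(ha R).analyticOrderAt_eq_natCast]
  refine ⟨fun z => H.eval z, ha H, fun h0 => hHr (dvd_iff_isRoot.2 h0), .of_forall fun z => ?_⟩
  conv_lhs => rw [hH]
  simp

end Reciprocal

/-! ### Blaschke products -/

section Blaschke
open Filter Topology Polynomial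
open scoped ComplexConjugate

theorem one_sub_conj_mul_ne_zero {α z : ℂ} (hα : α ∈ ball (0 : ℂ) 1)
    (hz : z ∈ closedBall (0 : ℂ) 1) : 1 - conj α * z ≠ 0 := by
  intro h0
  have h1 : ‖conj α * z‖ = 1 := by rw [← sub_eq_zero.1 h0, norm_one]
  rw [norm_mul, RCLike.norm_conj] at h1
  have h2 := mem_ball_zero_iff.1 hα
  have h3 := mem_closedBall_zero_iff.1 hz
  nlinarith [norm_nonneg α, norm_nonneg z]

theorem normSq_one_sub_conj_mul_sub (α z : ℂ) :
    ‖1 - conj α * z‖ ^ 2 - ‖z - α‖ ^ 2 = (1 - ‖z‖ ^ 2) * (1 - ‖α‖ ^ 2) := by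
  simp only [Complex.sq_norm, Complex.normSq_apply]
  simp
  ring

theorem norm_blaschke_factor_lt_one {α z : ℂ} (hα : α ∈ ball (0 : ℂ) 1)
    (hz : z ∈ ball (0 : ℂ) 1) : ‖(z - α) / (1 - conj α * z)‖ < 1 := by
  have hd := norm_pos_iff.2 (one_sub_conj_mul_ne_zero hα (ball_subset_closedBall hz))
  rw [norm_div, div_lt_one hd]
  have h1 := normSq_one_sub_conj_mul_sub α z
  have h2 := mem_ball_zero_iff.1 hα
  have h3 := mem_ball_zero_iff.1 hz
  have h4 : 0 < (1 - ‖z‖ ^ 2) * (1 - ‖α‖ ^ 2) := by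
    apply mul_pos <;> nlinarith [norm_nonneg α, norm_nonneg z]
  exact lt_of_pow_lt_pow_left₀ 2 hd.le (by linarith)

theorem norm_blaschke_factor_eq_one {α z : ℂ} (hα : α ∈ ball (0 : ℂ) 1)
    (hz : z ∈ sphere (0 : ℂ) 1) : ‖(z - α) / (1 - conj α * z)‖ = 1 := by
  have hd := norm_pos_iff.2 (one_sub_conj_mul_ne_zero hα (sphere_subset_closedBall hz))
  rw [norm_div, div_eq_one_iff_eq hd.ne']
  have h1 := normSq_one_sub_conj_mul_sub α z
  rw [mem_sphere_zero_iff_norm.1 hz] at h1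
  refine (pow_left_inj₀ (norm_nonneg _) hd.le two_ne_zero).1 ?_
  linarith

/-- The quadratic polynomial `(z - α) * (1 - conj α * z)`, with zeros `α` and `1 / conj α`. -/
noncomputable def pairPolynomial (α : ℂ) : ℂ[X] := (X - C α) * (1 - C (conj α) * X)

/-- The numerator of `f' / f` for a Blaschke product `f` with zeros `A` of multiplicities `n`. -/
noncomputable def logDerivNumerator (A : Finset ℂ) (n : ℂ → ℕ) : ℂ[X] :=
  ∑ α ∈ A, C ((n α * (1 - ‖α‖ ^ 2) : ℝ) : ℂ) * ∏ α' ∈ A.erase α, pairPolynomial α'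

theorem natDegree_pairPolynomial_le (α : ℂ) : (pairPolynomial α).natDegree ≤ 2 :=
  natDegree_mul_le.trans (Nat.add_le_add (natDegree_X_sub_C_le α) (natDegree_one_sub_C_mul_X_le _))

theorem conjReflect_pairPolynomial (α : ℂ) :
    conjReflect 2 (pairPolynomial α) = pairPolynomial α := by
  have := conjReflect_mul (natDegree_X_sub_C_le α) (natDegree_one_sub_C_mul_X_le (conj α))
  rw [conjReflect_X_sub_C, conjReflect_one_sub] at this
  rw [pairPolynomial, this, mul_comm]

theorem eval_pairPolynomial (α z : ℂ) :
    (pairPolynomial α).eval z = (z - α) * (1 - conj α * z) := by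
  simp [pairPolynomial]

variable {c : ℂ} {A : Finset ℂ} {n : ℂ → ℕ}

theorem natDegree_logDerivNumerator_le :
    (logDerivNumerator A n).natDegree ≤ 2 * (A.card - 1) := by
  refine natDegree_sum_le_of_forall_le _ _ fun α hα => ?_
  refine (natDegree_C_mul_le _ _).trans ((natDegree_prod_le _ _).trans ?_)
  refine (Finset.sum_le_card_nsmul _ _ 2 fun i _ => natDegree_pairPolynomial_le i).trans ?_
  rw [Finset.card_erase_of_mem hα, smul_eq_mul, mul_comm]

theorem conjReflect_logDerivNumerator :
    conjReflect (2 * (A.card - 1)) (logDerivNumerator A n) = logDerivNumerator A n := by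
  rw [logDerivNumerator, conjReflect_sum]
  refine Finset.sum_congr rfl fun α hα => ?_
  rw [conjReflect_C_mul, ← Finset.card_erase_of_mem hα,
    conjReflect_prod _ _ fun i _ => natDegree_pairPolynomial_le i]
  simp only [conjReflect_pairPolynomial]

theorem eval_pairPolynomial_ne_zero {α z : ℂ} (hα : α ∈ ball (0 : ℂ) 1)
    (hz : z ∈ ball (0 : ℂ) 1) (hne : z ≠ α) : (pairPolynomial α).eval z ≠ 0 := by
  rw [eval_pairPolynomial]
  exact mul_ne_zero (sub_ne_zero.2 hne) (one_sub_conj_mul_ne_zero hα (ball_subset_closedBall hz))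

theorem logDerivNumerator_ne_zero (hA : ∀ α ∈ A, α ∈ ball (0 : ℂ) 1) (hn : ∀ α ∈ A, 1 ≤ n α)
    {α : ℂ} (hα : α ∈ A) : logDerivNumerator A n ≠ 0 := by
  intro h0
  have h1 : (logDerivNumerator A n).eval α = 0 := by rw [h0, eval_zero]
  -- at `α`, all summands but one vanish
  rw [logDerivNumerator, eval_finsetSum, Finset.sum_eq_single_of_mem α hα, eval_mul, eval_C,
    eval_prod] at h1
  · refine mul_ne_zero ?_ (Finset.prod_ne_zero_iff.2 fun i hi => ?_) h1
    · have h2 := mem_ball_zero_iff.1 (hA α hα)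
      have h3 : (1 : ℝ) ≤ n α := by exact_mod_cast hn α hα
      have h4 : 0 < 1 - ‖α‖ ^ 2 := by nlinarith [norm_nonneg α]
      exact_mod_cast (mul_pos (by linarith) h4).ne'
    · exact eval_pairPolynomial_ne_zero (hA i (Finset.mem_of_mem_erase hi)) (hA α hα)
        (Finset.ne_of_mem_erase hi).symm
  · intro β hβ hne
    rw [eval_mul, eval_prod, Finset.prod_eq_zero (Finset.mem_erase.2 ⟨hne.symm, hα⟩)
      (by simp [eval_pairPolynomial]), mul_zero]

theorem differentiableAt_blaschke_factor {α z : ℂ} (hα : α ∈ ball (0 : ℂ) 1)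
    (hz : z ∈ closedBall (0 : ℂ) 1) :
    DifferentiableAt ℂ (fun w => (w - α) / (1 - conj α * w)) z := by
  have := one_sub_conj_mul_ne_zero hα hz
  fun_prop (disch := assumption)

theorem differentiableAt_blaschkeProduct (hA : ∀ α ∈ A, α ∈ ball (0 : ℂ) 1) {z : ℂ}
    (hz : z ∈ closedBall (0 : ℂ) 1) : DifferentiableAt ℂ (blaschkeProduct c A n) z := by
  unfold blaschkeProduct
  exact (DifferentiableAt.fun_finsetProd fun α hα =>
    (differentiableAt_blaschke_factor (hA α hα) hz).fun_pow _).const_mul c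

theorem blaschkeProduct_eq_zero_iff (hc : ‖c‖ = 1) (hA : ∀ α ∈ A, α ∈ ball (0 : ℂ) 1)
    (hn : ∀ α ∈ A, 1 ≤ n α) {z : ℂ} (hz : z ∈ ball (0 : ℂ) 1) :
    blaschkeProduct c A n z = 0 ↔ z ∈ A := by
  have hc0 : c ≠ 0 := by rintro rfl; simp at hc
  rw [blaschkeProduct, mul_eq_zero, or_iff_right hc0, Finset.prod_eq_zero_iff]
  constructor
  · rintro ⟨α, hα, h0⟩
    have h1 := (div_eq_zero_iff.1
      ((pow_eq_zero_iff (Nat.one_le_iff_ne_zero.1 (hn α hα))).1 h0)).resolve_right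
      (one_sub_conj_mul_ne_zero (hA α hα) (ball_subset_closedBall hz))
    rwa [sub_eq_zero.1 h1]
  · intro hzA
    exact ⟨z, hzA, by rw [sub_self, zero_div, zero_pow (Nat.one_le_iff_ne_zero.1 (hn z hzA))]⟩

/-- The logarithmic derivative of a Blaschke product. -/
theorem deriv_blaschkeProduct (hc : ‖c‖ = 1) (hA : ∀ α ∈ A, α ∈ ball (0 : ℂ) 1)
    (hn : ∀ α ∈ A, 1 ≤ n α) {z : ℂ} (hz : z ∈ ball (0 : ℂ) 1) (hzA : z ∉ A) :
    deriv (blaschkeProduct c A n) z =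
      blaschkeProduct c A n z / (∏ α ∈ A, pairPolynomial α).eval z *
        (logDerivNumerator A n).eval z := by
  have hc0 : c ≠ 0 := by rintro rfl; simp at hc
  have hzc := ball_subset_closedBall hz
  have hf0 : blaschkeProduct c A n z ≠ 0 := fun h0 =>
    hzA ((blaschkeProduct_eq_zero_iff hc hA hn hz).1 h0)
  have hne : ∀ α ∈ A, z - α ≠ 0 := fun α hα h0 => hzA (by rwa [sub_eq_zero.1 h0])
  have hd0 : ∀ α ∈ A, 1 - conj α * z ≠ 0 := fun α hα => one_sub_conj_mul_ne_zero (hA α hα) hzc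
  have hq0 : ∀ α ∈ A, (pairPolynomial α).eval z ≠ 0 := fun α hα => by
    rw [eval_pairPolynomial]
    exact mul_ne_zero (hne α hα) (hd0 α hα)
  have hfac : ∀ α ∈ A, logDeriv (fun w => ((w - α) / (1 - conj α * w)) ^ n α) z =
      ((n α * (1 - ‖α‖ ^ 2) : ℝ) : ℂ) / (pairPolynomial α).eval z := by
    intro α hα
    have h1 := hne α hα
    have h2 := hd0 α hα
    have hder : HasDerivAt (fun w => (w - α) / (1 - conj α * w))
        ((1 - conj α * α) / (1 - conj α * z) ^ 2) z := by
      refine (((hasDerivAt_id z).sub_const α).fun_div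
        (((hasDerivAt_id z).const_mul (conj α)).const_sub 1) h2).congr_deriv ?_
      simp only [id]
      congr 1
      ring
    rw [logDeriv_fun_pow (differentiableAt_blaschke_factor (hA α hα) hzc), logDeriv_apply,
      hder.deriv, eval_pairPolynomial, Complex.conj_mul']
    push_cast
    field_simp
  have hlog : logDeriv (blaschkeProduct c A n) z =
      ∑ α ∈ A, ((n α * (1 - ‖α‖ ^ 2) : ℝ) : ℂ) / (pairPolynomial α).eval z := by
    rw [← Finset.sum_congr rfl hfac, ← logDeriv_prod]
    · exact logDeriv_const_mul z c hc0
    · exact fun α hα => pow_ne_zero _ (div_ne_zero (hne α hα) (hd0 α hα))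
    · exact fun α hα => (differentiableAt_blaschke_factor (hA α hα) hzc).fun_pow _
  have hR : (logDerivNumerator A n).eval z = (∏ α ∈ A, pairPolynomial α).eval z *
      ∑ α ∈ A, ((n α * (1 - ‖α‖ ^ 2) : ℝ) : ℂ) / (pairPolynomial α).eval z := by
    rw [logDerivNumerator, eval_finsetSum, Finset.mul_sum]
    refine Finset.sum_congr rfl fun α hα => ?_
    rw [← Finset.mul_prod_erase A pairPolynomial hα, eval_mul, eval_mul, eval_C]
    have := hq0 α hα
    field_simp
  have hprod : (∏ α ∈ A, pairPolynomial α).eval z ≠ 0 := by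
    rw [eval_prod]
    exact Finset.prod_ne_zero_iff.2 hq0
  rw [logDeriv_apply, div_eq_iff hf0] at hlog
  rw [hlog, hR]
  field_simp

theorem criticalSet_subset_roots (hc : ‖c‖ = 1) (hA : ∀ α ∈ A, α ∈ ball (0 : ℂ) 1)
    (hn : ∀ α ∈ A, 1 ≤ n α) (hne : A.Nonempty) :
    criticalSet (blaschkeProduct c A n) A ⊆ (logDerivNumerator A n).roots.toFinset := by
  rintro β ⟨hβ, hβA, hd⟩
  obtain ⟨α, hα⟩ := hne
  rw [deriv_blaschkeProduct hc hA hn hβ hβA] at hd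
  rw [Finset.mem_coe, Multiset.mem_toFinset, mem_roots (logDerivNumerator_ne_zero hA hn hα)]
  refine (mul_eq_zero.1 hd).resolve_left (div_ne_zero (fun h0 => hβA ?_) ?_)
  · exact (blaschkeProduct_eq_zero_iff hc hA hn hβ).1 h0
  · rw [eval_prod]
    exact Finset.prod_ne_zero_iff.2 fun α hα => eval_pairPolynomial_ne_zero (hA α hα) hβ
      fun h => hβA (h ▸ hα)

theorem isProperDiskMap_blaschkeProduct (hc : ‖c‖ = 1) (hA : ∀ α ∈ A, α ∈ ball (0 : ℂ) 1)
    (hn : ∀ α ∈ A, 1 ≤ n α) (hne : A.Nonempty) :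
    IsProperDiskMap (blaschkeProduct c A n) A where
  continuousOn z hz := (differentiableAt_blaschkeProduct hA hz).continuousAt.continuousWithinAt
  differentiableOn z hz := (differentiableAt_blaschkeProduct hA
    (ball_subset_closedBall hz)).differentiableWithinAt
  norm_lt_one z hz := by
    obtain ⟨α, hα⟩ := hne
    rw [blaschkeProduct, norm_mul, hc, one_mul, norm_prod, ← Finset.mul_prod_erase _ _ hα]
    simp only [norm_pow]
    have h1 : ‖(z - α) / (1 - conj α * z)‖ ^ n α < 1 :=
      pow_lt_one₀ (norm_nonneg _) (norm_blaschke_factor_lt_one (hA α hα) hz)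
        (Nat.one_le_iff_ne_zero.1 (hn α hα))
    have h2 : ∏ i ∈ A.erase α, ‖(z - i) / (1 - conj i * z)‖ ^ n i ≤ 1 :=
      Finset.prod_le_one (fun i _ => by positivity) fun i hi => pow_le_one₀ (norm_nonneg _)
        (norm_blaschke_factor_lt_one (hA i (Finset.mem_of_mem_erase hi)) hz).le
    exact (mul_le_of_le_one_right (by positivity) h2).trans_lt h1
  norm_eq_one z hz := by
    rw [blaschkeProduct, norm_mul, hc, one_mul, norm_prod]
    refine Finset.prod_eq_one fun α hα => ?_
    rw [norm_pow, norm_blaschke_factor_eq_one (hA α hα) hz, one_pow]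
  mem_zeros z := by
    constructor
    · intro hz
      exact ⟨hA z hz, (blaschkeProduct_eq_zero_iff hc hA hn (hA z hz)).2 hz⟩
    · rintro ⟨hz, h0⟩
      exact (blaschkeProduct_eq_zero_iff hc hA hn hz).1 h0
  finite_vertexSet := A.finite_toSet.union
    ((Finset.finite_toSet _).subset (criticalSet_subset_roots hc hA hn hne))

/-- The order of `f - f β` at a critical point `β` exceeds by one the multiplicity of `β` as a root
of the numerator of `f' / f`. -/
theorem analyticOrderNatAt_blaschkeProduct (hc : ‖c‖ = 1) (hA : ∀ α ∈ A, α ∈ ball (0 : ℂ) 1)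
    (hn : ∀ α ∈ A, 1 ≤ n α) (hne : A.Nonempty) {β : ℂ} (hβ : β ∈ ball (0 : ℂ) 1) (hβA : β ∉ A) :
    analyticOrderNatAt (fun z => blaschkeProduct c A n z - blaschkeProduct c A n β) β =
      (logDerivNumerator A n).rootMultiplicity β + 1 := by
  have h := isProperDiskMap_blaschkeProduct hc hA hn hne
  obtain ⟨α, hα⟩ := hne
  have hR := logDerivNumerator_ne_zero hA hn hα
  have hev : deriv (blaschkeProduct c A n) =ᶠ[𝓝 β] fun z =>
      (blaschkeProduct c A n z / (∏ α ∈ A, pairPolynomial α).eval z) *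
        (logDerivNumerator A n).eval z := by
    filter_upwards [isOpen_ball.mem_nhds hβ, A.finite_toSet.isClosed.isOpen_compl.mem_nhds hβA]
      with z hz hzA
    exact deriv_blaschkeProduct hc hA hn hz hzA
  have hpoly : ∀ P : ℂ[X], AnalyticAt ℂ (fun z => P.eval z) β := fun P => by
    simpa using AnalyticAt.aeval_polynomial (analyticAt_id (𝕜 := ℂ) (z := β)) P
  have hq : (∏ α ∈ A, pairPolynomial α).eval β ≠ 0 := by
    rw [eval_prod]
    exact Finset.prod_ne_zero_iff.2 fun α hα => eval_pairPolynomial_ne_zero (hA α hα) hβ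
      fun h => hβA (h ▸ hα)
  have hu : AnalyticAt ℂ (fun z => blaschkeProduct c A n z /
      (∏ α ∈ A, pairPolynomial α).eval z) β := (h.analyticAt hβ).fun_div (hpoly _) hq
  have hu0 : analyticOrderAt (fun z => blaschkeProduct c A n z /
      (∏ α ∈ A, pairPolynomial α).eval z) β = 0 :=
    hu.analyticOrderAt_eq_zero.2 (div_ne_zero (fun h0 => hβA
      ((blaschkeProduct_eq_zero_iff hc hA hn hβ).1 h0)) hq)
  have h1 := (h.analyticAt hβ).analyticOrderAt_deriv_add_one
  rw [analyticOrderAt_congr hev, show (fun z => (blaschkeProduct c A n z /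
    (∏ α ∈ A, pairPolynomial α).eval z) * (logDerivNumerator A n).eval z) =
    (fun z => blaschkeProduct c A n z / (∏ α ∈ A, pairPolynomial α).eval z) *
      (fun z => (logDerivNumerator A n).eval z) from rfl, analyticOrderAt_mul hu (hpoly _), hu0,
    zero_add, analyticOrderAt_eval hR] at h1
  rw [analyticOrderNatAt, ← h1]
  exact_mod_cast ENat.toNat_natCast _

/-- The Riemann-Hurwitz count: the orders of the critical points add up to less than the number of
vertices. It rests on the symmetry of the zeros of `f'` under reflection in the circle. -/
theorem sum_order_blaschkeProduct_le (hc : ‖c‖ = 1) (hA : ∀ α ∈ A, α ∈ ball (0 : ℂ) 1)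
    (hn : ∀ α ∈ A, 1 ≤ n α) (h0 : (0 : ℂ) ∈ A)
    (hfin : (criticalSet (blaschkeProduct c A n) A).Finite) :
    ∑ β ∈ hfin.toFinset,
        analyticOrderNatAt (fun z => blaschkeProduct c A n z - blaschkeProduct c A n β) β + 1 ≤
      (vertexSet (blaschkeProduct c A n) A).ncard := by
  have hsum := two_mul_sum_rootMultiplicity_le (logDerivNumerator_ne_zero hA hn h0)
    natDegree_logDerivNumerator_le conjReflect_logDerivNumerator hfin.toFinset
    (fun β hβ => (hfin.mem_toFinset.1 hβ).1) (fun hβ => (hfin.mem_toFinset.1 hβ).2.1 h0)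
  have hord : ∑ β ∈ hfin.toFinset,
        analyticOrderNatAt (fun z => blaschkeProduct c A n z - blaschkeProduct c A n β) β =
      ∑ β ∈ hfin.toFinset, ((logDerivNumerator A n).rootMultiplicity β + 1) :=
    Finset.sum_congr rfl fun β hβ => by
      obtain ⟨hb, hbA, -⟩ := hfin.mem_toFinset.1 hβ
      exact analyticOrderNatAt_blaschkeProduct hc hA hn ⟨0, h0⟩ hb hbA
  have hcard : (vertexSet (blaschkeProduct c A n) A).ncard = A.card + hfin.toFinset.card := by
    rw [vertexSet, ncard_union_eq (disjoint_left.2 fun z hz hz' => hz'.2.1 hz) A.finite_toSet hfin,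
      ncard_coe_finset, ncard_eq_toFinset_card _ hfin]
  have hpos : 0 < A.card := Finset.card_pos.2 ⟨0, h0⟩
  rw [hord, hcard, Finset.sum_add_distrib, Finset.sum_const, smul_eq_mul, mul_one]
  omega

/-- The length bound for paths of steepest descent of a Blaschke product of degree `∑ n`. -/
theorem eVariationOn_blaschkeProduct_le (hc : ‖c‖ = 1) (hA : ∀ α ∈ A, α ∈ ball (0 : ℂ) 1)
    (hn : ∀ α ∈ A, 1 ≤ n α) (hne : A.Nonempty) {γ : ℝ → ℂ} {a b : ℝ}
    (hγ : IsSteepestDescent (blaschkeProduct c A n) γ a b) (ha : γ a ∈ ball (0 : ℂ) 1) :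
    eVariationOn γ (Icc a b) ≤
      ENNReal.ofReal (2 * Real.pi * ((∑ α ∈ A, n α : ℕ) : ℝ)) := by
  refine hγ.eVariationOn_le (P := C c * ∏ α ∈ A, (X - C α) ^ n α)
    (Q := ∏ α ∈ A, (1 - C (conj α) * X) ^ n α)
    (isProperDiskMap_blaschkeProduct hc hA hn hne) ha ?_ ?_ ?_ ?_
  · refine (natDegree_C_mul_le _ _).trans ((natDegree_prod_le _ _).trans ?_)
    exact Finset.sum_le_sum fun α _ => by simp
  · refine (natDegree_prod_le _ _).trans (Finset.sum_le_sum fun α _ => ?_)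
    refine natDegree_pow_le.trans ?_
    simpa using Nat.mul_le_mul_left (n α) (natDegree_one_sub_C_mul_X_le (conj α))
  · intro z hz
    rw [eval_prod]
    refine Finset.prod_ne_zero_iff.2 fun α hα => ?_
    simpa using fun h0 => absurd h0
      (one_sub_conj_mul_ne_zero (hA α hα) (ball_subset_closedBall hz))
  · intro z _
    simp only [blaschkeProduct, div_pow, Finset.prod_div_distrib, eval_mul, eval_C, eval_prod,
      eval_pow, eval_sub, eval_X, eval_one]
    ring

end Blaschke

/-! ### Continuation of paths to the zeros -/

section Continuation

/-- From every point of the disk that is not a zero, a path of steepest descent leads to a zero;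
its starting time can be prescribed. -/
theorem IsProperDiskMap.exists_isSteepestDescent {f : ℂ → ℂ} {A : Set ℂ}
    (h : IsProperDiskMap f A) {z : ℂ} (hz : z ∈ ball (0 : ℂ) 1) (hzA : z ∉ A) (a : ℝ) :
    ∃ γ b, IsSteepestDescent f γ a b ∧ γ a = z ∧ γ b ∈ A := by
  obtain ⟨u, σ, hσ, hσz, hA⟩ := h.exists_isRayLift_zero hz
  have hpos : 0 < ‖f z‖ := norm_pos_iff.2 fun h0 => hzA ((h.mem_zeros z).2 ⟨hz, h0⟩)
  have hd := hσ.isSteepestDescent h hpos (a + ‖f z‖)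
  rw [add_sub_cancel_right, sub_zero] at hd
  exact ⟨_, _, hd, by simp [hσz], by simpa using hA⟩

/-- Every path of steepest descent in the disk can be continued to a zero. -/
theorem IsSteepestDescent.exists_continuation {f : ℂ → ℂ} {A : Set ℂ} {γ : ℝ → ℂ} {a b : ℝ}
    (hγ : IsSteepestDescent f γ a b) (h : IsProperDiskMap f A) (ha : γ a ∈ ball (0 : ℂ) 1) :
    ∃ (δ : ℝ → ℂ) (d : ℝ), b ≤ d ∧ EqOn δ γ (Icc a b) ∧ IsSteepestDescent f δ a d ∧ δ d ∈ A := by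
  by_cases hb : γ b ∈ A
  · exact ⟨γ, b, le_rfl, eqOn_refl _ _, hγ, hb⟩
  obtain ⟨δ, d, hδ, hδb, hδd⟩ := h.exists_isSteepestDescent (hγ.mem_ball h ha hγ.right_mem) hb b
  obtain ⟨ρ, hρ, h1, h2⟩ := hγ.trans hδ hδb.symm
  exact ⟨ρ, d, hδ.lt.le, h1, hρ, by rwa [h2 hδ.right_mem]⟩

end Continuation

theorem mainTheorem5 (c : ℂ) (A : Finset ℂ) (n : ℂ → ℕ) (f : ℂ → ℂ)
    (hc : ‖c‖ = 1)
    (hA : ∀ α ∈ A, α ∈ ball (0 : ℂ) 1)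
    (hn : ∀ α ∈ A, 1 ≤ n α)
    (hf : f = blaschkeProduct c A n)
    (hf0 : f 0 = 0) (hf1 : f 1 = 1) :
    -- paths of steepest descent starting in the disk remain in the disk
    (∀ (γ : ℝ → ℂ) (a b : ℝ), IsSteepestDescent f γ a b → γ a ∈ ball (0 : ℂ) 1 →
      ∀ t ∈ Icc a b, γ t ∈ ball (0 : ℂ) 1) ∧
    -- they start at every point of `D ∖ A`, and each can be continued to a point of `A`
    (∀ β ∈ ball (0 : ℂ) 1, β ∉ A →
      ∃ (γ : ℝ → ℂ) (a b : ℝ), IsSteepestDescent f γ a b ∧ γ a = β ∧ γ b ∈ A) ∧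
    (∀ (γ : ℝ → ℂ) (a b : ℝ), IsSteepestDescent f γ a b → γ a ∈ ball (0 : ℂ) 1 →
      ∃ (δ : ℝ → ℂ) (d : ℝ), b ≤ d ∧ EqOn δ γ (Icc a b) ∧
        IsSteepestDescent f δ a d ∧ δ d ∈ A) ∧
    -- the `s + p - 1` edge curves meet only at vertices and draw the edges of a tree on `A ∪ B`
    (criticalSet f A).Finite ∧
    (edgeCurves f A).encard + 1 = (A : Set ℂ).encard + (criticalSet f A).encard ∧
    (∀ C ∈ edgeCurves f A, ∀ C' ∈ edgeCurves f A, C ≠ C' → C ∩ C' ⊆ vertexSet f A) ∧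
    (∀ (γ₁ γ₂ : ℝ → ℂ) (a₁ b₁ a₂ b₂ : ℝ),
      IsEdgePath f A γ₁ a₁ b₁ → IsEdgePath f A γ₂ a₂ b₂ → γ₁ a₁ = γ₂ a₂ → γ₁ b₁ = γ₂ b₂ →
      γ₁ '' Icc a₁ b₁ = γ₂ '' Icc a₂ b₂) ∧
    (descentGraph f A).IsTree ∧
    -- every path of steepest descent from `D ∖ A` to `A` has length at most `2 π N`
    (∀ (γ : ℝ → ℂ) (a b : ℝ), IsSteepestDescent f γ a b →
      γ a ∈ ball (0 : ℂ) 1 → γ a ∉ A → γ b ∈ A →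
      eVariationOn γ (Icc a b) ≤
        ENNReal.ofReal (2 * Real.pi * ((∑ α ∈ A, n α : ℕ) : ℝ))) := by
  subst hf
  have h0 : (0 : ℂ) ∈ A := (blaschkeProduct_eq_zero_iff hc hA hn (by simp)).1 hf0
  have hne : A.Nonempty := ⟨0, h0⟩
  have h := isProperDiskMap_blaschkeProduct hc hA hn hne
  have hfin : (criticalSet (blaschkeProduct c A n) A).Finite :=
    h.finite_vertexSet.subset subset_union_right
  obtain ⟨htree, hcount, huniq⟩ := h.isTree_of_sum_order_le hfin
    (sum_order_blaschkeProduct_le hc hA hn h0 hfin)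
  refine ⟨fun γ a b hγ ha t ht => hγ.mem_ball h ha ht, fun β hβ hβA => ?_,
    fun γ a b hγ ha => hγ.exists_continuation h ha, hfin, ?_, ?_, huniq, htree,
    fun γ a b hγ ha _ _ => eVariationOn_blaschkeProduct_le hc hA hn hne hγ ha⟩
  · obtain ⟨γ, b, hγ⟩ := h.exists_isSteepestDescent hβ (by simpa using hβA) 0
    exact ⟨γ, 0, b, hγ⟩
  · rw [hcount, vertexSet, encard_union_eq (disjoint_left.2 fun z hz hz' => hz'.2.1 hz)]
  · rintro C ⟨γ, a, b, hγ, rfl⟩ C' ⟨γ', a', b', hγ', rfl⟩ hCC p ⟨hp, hp'⟩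
    by_contra hv
    obtain ⟨u, σ, x₁, x₀, hσ, -, -, him⟩ := hγ.exists_isEdgeLift h
    obtain ⟨u', σ', x₁', x₀', hσ', -, -, him'⟩ := hγ'.exists_isEdgeLift h
    rw [← him] at hp hCC
    rw [← him'] at hp' hCC
    exact hCC (h.edgeLift_eq hσ hσ' hp hp' hv)
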